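/- Let $H_n^{(q)}:=\sum_{k=1}^n k^{-q}$ (with $H_0^{(q)}=0$), let $\zeta$ be the Riemann zeta function with the conventions $\zeta(0):=-\tfrac12$ and $\zeta(1):=0$ wherever these occur, and for $c\in\mathbb C\setminus\mathbb Z$ let $\zeta(s;c):=\sum_{n\ge 0}(n+c)^{-s}$ for integers $s\ge2$ and $\zeta(1;c):=-(\psi(c)+\gamma)$, where $\psi=\Gamma'/\Gamma$ and $\gamma$ is Euler's constant. For integers $p,m\ge1$ and complex numbers $a,b$, put $$T_{p,m}(a,b):=\sum_{\substack{2k_1+k_2\le m+1\\ k_1\ge0,\ k_2\ge1}}(-1)^{k_2}\binom{k_2+p-2}{p-1}\zeta(2k_1)\Big\{\zeta(k_2+p-1)\big[\zeta(e;a)-\zeta(e;b)\big]-(-1)^{p+k_2}\sum_{n=0}^\infty\Big[\frac{H_n^{(k_2+p-1)}}{(n+a)^{e}}-\frac{H_n^{(k_2+p-1)}}{(n+b)^{e}}\Big]\Big\},$$ where $e=e(k_1,k_2):=m-2k_1-k_2+2\ge1$. **Theorem.** For all integers $p,m\ge 1$ and all $a,b\in\mathbb C\setminus\mathbb Z$ with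 $a\ne b$, all the series below (including those in $T_{p,m}$ and $T_{m,p}$) converge absolutely, and $$\begin{aligned} &\sum_{n=1}^\infty\frac{H_n^{(p)}H_n^{(m)}}{(n+a)(n+b)}+(-1)^{p+m}\sum_{n=1}^\infty\frac{H_{n-1}^{(p)}H_{n-1}^{(m)}}{(n-a)(n-b)}\\ &+(-1)^m\zeta(m)\sum_{n=1}^\infty\frac{H_n^{(p)}}{(n+a)(n+b)}+(-1)^p\zeta(p)\sum_{n=1}^\infty\frac{H_n^{(m)}}{(n+a)(n+b)}\\ &-(-1)^{p+m}\zeta(m)\sum_{n=1}^\infty\frac{H_{n-1}^{(p)}}{(n-a)(n-b)}-(-1)^{p+m}\zeta(p)\sum_{n=1}^\infty\frac{H_{n-1}^{(m)}}{(n-a)(n-b)}\\ &+(-1)^{p+m}\frac{\pi\cot(\pi b)}{b-a}\big\{\zeta(p;b)\zeta(m;b)-\zeta(p)\zeta(m)\big\}\\ &-(-1)^{p+m}\frac{\pi\cot(\pi a)}{b-a}\big\{\zeta(p;a)\zeta(m;a)-\zeta(p)\zeta(m)\big\}\\ &-2\frac{(-1)^{p+m}}{b-a}\sum_{k=0}^{\lfloor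 (p+m)/2\rfloor}\zeta(2k)\big\{\zeta(p+m-2k+1;a)-\zeta(p+m-2k+1;b)\big\}\\ &+2\frac{(-1)^{p+m}}{b-a}T_{p,m}(a,b)+2\frac{(-1)^{p+m}}{b-a}T_{m,p}(a,b)=0 . \end{aligned}$$ -/

import Mathlib

noncomputable section

/-- The generalized harmonic number `H_n^{(p)} = ∑_{k=1}^n 1 / k^p`, as a complex number. -/
def genHarmonic (p n : ℕ) : ℂ :=
  ∑ k ∈ Finset.Icc 1 n, 1 / (k : ℂ) ^ p

/-- The values `ζ(s)` at natural numbers, with the conventions `ζ(0) = -1/2` and `ζ(1) = 0`. -/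
def zetaNat (s : ℕ) : ℂ :=
  if s = 0 then -1 / 2 else if s = 1 then 0 else riemannZeta (s : ℂ)

/-- The Hurwitz zeta value `ζ(s; a) = ∑_{n ≥ 0} 1 / (n + a)^s` for integers `s ≥ 2`, with the
convention `ζ(1; a) = -(ψ(a) + γ)`. Mathlib's `hurwitzZeta` only covers real parameters modulo
`1`, while here `a` is any complex number that is not an integer. -/
def hurwitzNat (s : ℕ) (a : ℂ) : ℂ :=
  if s = 1 then -(Complex.digamma a + (Real.eulerMascheroniConstant : ℂ))
  else ∑' n : ℕ, 1 / ((n : ℂ) + a) ^ s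

/-- The pairs `(k₁, k₂)` of integers with `k₁ ≥ 0`, `k₂ ≥ 1` and `2 k₁ + k₂ ≤ M`. -/
def indexPairs (M : ℕ) : Finset (ℕ × ℕ) :=
  (Finset.range (M + 1) ×ˢ Finset.Icc 1 M).filter (fun k => 2 * k.1 + k.2 ≤ M)

/-- The index set is the intended one. -/
theorem mem_indexPairs (M : ℕ) (k : ℕ × ℕ) :
    k ∈ indexPairs M ↔ 1 ≤ k.2 ∧ 2 * k.1 + k.2 ≤ M := by
  simp only [indexPairs, Finset.mem_filter, Finset.mem_product, Finset.mem_range, Finset.mem_Icc]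
  omega

/-- The series in the definition of the Hurwitz zeta values converges for `s ≥ 2`. -/
theorem summable_hurwitzNat (s : ℕ) (hs : 2 ≤ s) (a : ℂ) :
    Summable (fun n : ℕ => 1 / ((n : ℂ) + a) ^ s) := by
  have h1 : Summable (fun n : ℕ => 1 / (n : ℝ) ^ s) :=
    Real.summable_one_div_nat_pow.mpr (by omega)
  refine summable_of_isBigO_nat h1 ?_
  refine Asymptotics.IsBigO.of_bound (2 ^ s) ?_
  obtain ⟨N, hN⟩ := exists_nat_gt (2 * ‖a‖)
  filter_upwards [Filter.eventually_ge_atTop (N + 1)] with n hn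
  have hn' : (N : ℝ) + 1 ≤ n := by exact_mod_cast hn
  have ha : 0 ≤ ‖a‖ := norm_nonneg a
  have hpos : (0 : ℝ) < n := by linarith
  have hlow : (n : ℝ) / 2 ≤ ‖(n : ℂ) + a‖ := by
    have := norm_sub_le_norm_add (n : ℂ) a
    rw [Complex.norm_natCast] at this
    linarith
  rw [norm_div, norm_div, norm_one, norm_one, norm_pow, norm_pow, Real.norm_natCast]
  calc 1 / ‖(n : ℂ) + a‖ ^ s ≤ 1 / ((n : ℝ) / 2) ^ s := by gcongr
    _ = 2 ^ s * (1 / (n : ℝ) ^ s) := by rw [div_pow]; field_simp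

/-- One of the two double sums: the sum over `k₁ ≥ 0`, `k₂ ≥ 1`, `2 k₁ + k₂ ≤ m + 1` of
`(-1)^{k₂} C(k₂+p-2, p-1) ζ(2k₁)` times
`ζ(k₂+p-1) [ζ(e; a) - ζ(e; b)]
  - (-1)^{p+k₂} ∑_{n ≥ 0} [H_n^{(k₂+p-1)} / (n+a)^e - H_n^{(k₂+p-1)} / (n+b)^e]`
where `e = m - 2k₁ - k₂ + 2 ≥ 1`. -/
def crossSum (p m : ℕ) (a b : ℂ) : ℂ :=
  ∑ k ∈ indexPairs (m + 1),
    (-1) ^ k.2 * ((k.2 + p - 2).choose (p - 1) : ℂ) * zetaNat (2 * k.1) *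
      (zetaNat (k.2 + p - 1) *
          (hurwitzNat (m + 2 - 2 * k.1 - k.2) a - hurwitzNat (m + 2 - 2 * k.1 - k.2) b)
        - (-1) ^ (p + k.2) *
          ∑' n : ℕ, (genHarmonic (k.2 + p - 1) n / ((n : ℂ) + a) ^ (m + 2 - 2 * k.1 - k.2)
            - genHarmonic (k.2 + p - 1) n / ((n : ℂ) + b) ^ (m + 2 - 2 * k.1 - k.2)))

end

/-! ### Partial fractions from Liouville's theorem. -/

section PartialFractions

open Filter Topology

/-! The kernel `π cot(πs) ζ(p;s) ζ(m;s)` has poles of order `p + m + 1` at `0, -1, -2, …` and at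
most simple poles at `1, 2, …`. The theorem is the difference of its Mittag-Leffler expansion at `s
= a` and `s = b`, multiplied by `-(-1)^(p+m)/(b-a)`.

No contour is used. The three factors are truncated at a common `N`, giving `truncCot` and
`truncHurwitz`; their product is a rational function vanishing at infinity, so by Liouville
(`eq_sum_principalParts`) it equals the sum of its principal parts. This is
`truncCot_mul_truncHurwitz_mul`. At `-n` the principal part comes from Taylor coefficients
(`exists_principalPart`), which are harmonic numbers cut off at `N`. Divergent harmonic sums for `q
= 1` are regularized by subtracting `H_{N+1}`; this produces both `ζ(1) = 0` and `ζ(1;c) = -(ψ(c) +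
γ)`.

Then `N → ∞`. The coefficients at `-n` are `O(√(n+1))` uniformly in `N`, while `1/(n+a)^e -
1/(n+b)^e` is `O(1/(n+1)^2)`, so dominated convergence (`DominatedLimit.tendsto_sum`) gives
`cot_mul_hurwitzNat_sub`. In the limit, the leading cotangent coefficients give the single sum over
`ζ(2k)`, and the products of cotangent coefficients with those of one Hurwitz factor give the two
cross sums (`sum_diffSeries_eq_crossSum`). The remaining simple poles give the series in products of
harmonic numbers, and `cot_sub_cot` absorbs their constant part `ζ(p)ζ(m)`. -/

/-- A function on `ℂ` that vanishes at infinity and whose only singularities are prescribed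
principal parts, themselves vanishing at infinity, is the sum of these principal parts. -/
theorem eq_sum_principalParts {ι : Type*} [DecidableEq ι] (P : Finset ι) (c : ι → ℂ)
    (hc : Set.InjOn c P) (f : ℂ → ℂ) (g : ι → ℂ → ℂ)
    (hg : ∀ i ∈ P, ∀ s, s ≠ c i → DifferentiableAt ℂ (g i) s)
    (hg0 : ∀ i ∈ P, Tendsto (g i) (cocompact ℂ) (𝓝 0))
    (hf : ∀ s, (∀ i ∈ P, s ≠ c i) → DifferentiableAt ℂ f s)
    (hf0 : Tendsto f (cocompact ℂ) (𝓝 0))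
    (hr : ∀ i ∈ P, ∃ R : ℂ → ℂ, DifferentiableAt ℂ R (c i) ∧
      ∀ᶠ s in 𝓝[≠] (c i), f s = g i s + R s)
    (s : ℂ) (hs : ∀ i ∈ P, s ≠ c i) : f s = ∑ i ∈ P, g i s := by
  classical
  choose! R hRd hR using hr
  set h : ℂ → ℂ := fun s => f s - ∑ i ∈ P, g i s with hh
  -- Near `c i`, off the point itself, `h` coincides with `A i`, which is differentiable at `c i`;
  -- its value there fills the removable singularity, and `H` is the resulting entire function.
  set A : ι → ℂ → ℂ := fun i s => R i s - ∑ j ∈ P.erase i, g j s with hA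
  set H : ℂ → ℂ := fun s => if hs : ∃ i ∈ P, s = c i then A hs.choose s else h s with hH
  have hHc : ∀ i ∈ P, H (c i) = A i (c i) := by
    intro i hi
    have hex : ∃ j ∈ P, c i = c j := ⟨i, hi, rfl⟩
    have : hex.choose = i := (hc hi hex.choose_spec.1 hex.choose_spec.2).symm
    simp only [hH, dif_pos hex, this]
  have hHn : ∀ s, (∀ i ∈ P, s ≠ c i) → H s = h s := by
    intro s hs
    have : ¬ ∃ i ∈ P, s = c i := by rintro ⟨i, hi, h⟩; exact hs i hi h
    simp only [hH, dif_neg this]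
  have hfin : ∀ s : ℂ, ∀ᶠ z in 𝓝[≠] s, ∀ i ∈ P, z ≠ c i := by
    intro s
    rw [Filter.eventually_all_finset]
    intro i _
    by_cases h : s = c i
    · rw [h]; exact eventually_mem_nhdsWithin
    · exact (eventually_ne_nhds h).filter_mono nhdsWithin_le_nhds
  have hdiff : Differentiable ℂ H := by
    intro s
    by_cases hs : ∀ i ∈ P, s ≠ c i
    · have : H =ᶠ[𝓝 s] h := by
        have h1 := hfin s
        rw [eventually_nhdsWithin_iff] at h1
        filter_upwards [h1] with z hz
        by_cases hzs : z = s
        · rw [hzs]; exact hHn s hs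
        · exact hHn z (hz hzs)
      refine DifferentiableAt.congr_of_eventuallyEq ?_ this
      exact (hf s hs).sub (DifferentiableAt.fun_sum fun i hi => hg i hi s (hs i hi))
    · push Not at hs
      obtain ⟨i, hi, rfl⟩ := hs
      have : H =ᶠ[𝓝 (c i)] A i := by
        have h1 := (hfin (c i)).and (hR i hi)
        rw [eventually_nhdsWithin_iff] at h1
        filter_upwards [h1] with z hz
        by_cases hzs : z = c i
        · rw [hzs]; exact hHc i hi
        · obtain ⟨h2, h3⟩ := hz hzs
          rw [hHn z h2]
          simp only [hh, hA, h3]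
          rw [← Finset.add_sum_erase P _ hi]
          ring
      refine DifferentiableAt.congr_of_eventuallyEq ?_ this
      refine (hRd i hi).sub (DifferentiableAt.fun_sum fun j hj => ?_)
      rw [Finset.mem_erase] at hj
      exact hg j hj.2 _ fun h => hj.1 (hc hi hj.2 h).symm
  have hlim : Tendsto H (cocompact ℂ) (𝓝 0) := by
    have h1 : Tendsto h (cocompact ℂ) (𝓝 0) := by
      simpa using hf0.sub (tendsto_finsetSum P fun i hi => hg0 i hi)
    refine h1.congr' ?_
    have : ∀ᶠ z in cocompact ℂ, ∀ i ∈ P, z ≠ c i := by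
      rw [Filter.eventually_all_finset]
      intro i _
      exact (isCompact_singleton (x := c i)).compl_mem_cocompact
    filter_upwards [this] with z hz
    exact (hHn z hz).symm
  -- Liouville: an entire function tending to `0` at infinity is `0`.
  have h0 : H s = 0 := hdiff.apply_eq_of_tendsto_cocompact s hlim
  rw [hHn s hs] at h0
  exact sub_eq_zero.mp h0

end PartialFractions

/-! ### Taylor expansions at `0` with differentiable remainder. -/

section Taylor

open Filter Topology

/-- `A` is analytic at `0` with Taylor coefficients `a`. -/
def HasTaylorCoeffs (A : ℂ → ℂ) (a : ℕ → ℂ) : Prop :=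
  ∀ K : ℕ, ∃ R : ℂ → ℂ, DifferentiableAt ℂ R 0 ∧
    ∀ᶠ x in 𝓝 (0 : ℂ), A x = ∑ k ∈ Finset.range K, a k * x ^ k + x ^ K * R x

namespace HasTaylorCoeffs

variable {A B : ℂ → ℂ} {a b : ℕ → ℂ}

/-- Each passage to the divided slope `dslope` shifts the power series by one and keeps it analytic,
so iterating it `K` times yields the remainder. -/
theorem of_hasFPowerSeriesAt {p : FormalMultilinearSeries ℂ ℂ ℂ}
    (h : HasFPowerSeriesAt A p 0) : HasTaylorCoeffs A p.coeff := by
  intro K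
  induction K generalizing A p with
  | zero => exact ⟨A, h.differentiableAt, by simp⟩
  | succ K ih =>
    obtain ⟨R, hR, hA⟩ := ih h.has_fpower_series_dslope_fslope
    refine ⟨R, hR, ?_⟩
    filter_upwards [hA] with x hx
    have h1 := sub_smul_dslope A 0 x
    rw [hx, sub_zero, smul_eq_mul, ← h.coeff_zero 1] at h1
    rw [eq_add_of_sub_eq h1.symm, Finset.sum_range_succ', mul_add, Finset.mul_sum]
    simp only [FormalMultilinearSeries.coeff_fslope, pow_succ]
    have : p.coeff 0 = p 0 1 := by
      simp only [FormalMultilinearSeries.coeff]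
    rw [this, pow_zero, mul_one]
    have h2 : ∀ k ∈ Finset.range K, x * (p.coeff (k + 1) * x ^ k) = p.coeff (k + 1) * (x ^ k * x) := by
      intros; ring
    rw [Finset.sum_congr rfl h2]
    ring

theorem zero : HasTaylorCoeffs (fun _ => 0) (fun _ => 0) := fun K =>
  ⟨fun _ => 0, differentiableAt_const _, by simp⟩

theorem add (hA : HasTaylorCoeffs A a) (hB : HasTaylorCoeffs B b) :
    HasTaylorCoeffs (fun x => A x + B x) (fun k => a k + b k) := by
  intro K
  obtain ⟨R, hR, h1⟩ := hA K
  obtain ⟨S, hS, h2⟩ := hB K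
  refine ⟨fun x => R x + S x, hR.add hS, ?_⟩
  filter_upwards [h1, h2] with x h1 h2
  rw [h1, h2]
  simp only [add_mul, Finset.sum_add_distrib]
  ring

theorem const_mul (c : ℂ) (hA : HasTaylorCoeffs A a) :
    HasTaylorCoeffs (fun x => c * A x) (fun k => c * a k) := by
  intro K
  obtain ⟨R, hR, h1⟩ := hA K
  refine ⟨fun x => c * R x, hR.const_mul c, ?_⟩
  filter_upwards [h1] with x h1
  rw [h1, mul_add, Finset.mul_sum]
  simp only [mul_assoc, mul_left_comm]

theorem sum {ι : Type*} (s : Finset ι) {A : ι → ℂ → ℂ} {a : ι → ℕ → ℂ}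
    (h : ∀ i ∈ s, HasTaylorCoeffs (A i) (a i)) :
    HasTaylorCoeffs (fun x => ∑ i ∈ s, A i x) (fun k => ∑ i ∈ s, a i k) := by
  classical
  induction s using Finset.induction_on with
  | empty => simpa using zero
  | insert i s hi ih =>
    simp only [Finset.sum_insert hi]
    exact (h i (Finset.mem_insert_self i s)).add
      (ih fun j hj => h j (Finset.mem_insert_of_mem hj))

/-- Prepending a constant term. -/
theorem cons (c : ℂ) (hA : HasTaylorCoeffs A a) :
    HasTaylorCoeffs (fun x => c + x * A x) (fun k => Nat.casesOn k c a) := by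
  intro K
  cases K with
  | zero =>
    obtain ⟨R, hR, h1⟩ := hA 0
    refine ⟨fun x => c + x * R x, ?_, ?_⟩
    · fun_prop
    · filter_upwards [h1] with x h1
      simp [h1]
  | succ K =>
    obtain ⟨R, hR, h1⟩ := hA K
    refine ⟨R, hR, ?_⟩
    filter_upwards [h1] with x h1
    rw [h1, Finset.sum_range_succ', mul_add, Finset.mul_sum]
    simp only [pow_succ, pow_zero, mul_one]
    rw [Finset.sum_congr rfl fun k _ => show x * (a k * x ^ k) = a k * (x ^ k * x) by ring]
    change _ = _ + c + _
    ring

/-- The order-one remainder is itself a valid quotient `(A x - a 0) / x`: dividing the expansion of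
order `K + 1` by `x` gives its expansion of order `K`. This is the induction step for products. -/
theorem tail (hA : HasTaylorCoeffs A a) : ∃ A' : ℂ → ℂ,
    HasTaylorCoeffs A' (fun k => a (k + 1)) ∧ ∀ᶠ x in 𝓝 (0 : ℂ), A x = a 0 + x * A' x := by
  obtain ⟨R, hR, h1⟩ := hA 1
  have hR1 : ∀ᶠ x in 𝓝 (0 : ℂ), A x = a 0 + x * R x := by
    filter_upwards [h1] with x h1
    simpa using h1
  refine ⟨R, fun K => ?_, hR1⟩
  obtain ⟨S, hS, h2⟩ := hA (K + 1)
  refine ⟨S, hS, ?_⟩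
  have hne : ∀ᶠ x in 𝓝[≠] (0 : ℂ), R x = ∑ k ∈ Finset.range K, a (k + 1) * x ^ k + x ^ K * S x := by
    filter_upwards [hR1.filter_mono nhdsWithin_le_nhds, h2.filter_mono nhdsWithin_le_nhds,
      self_mem_nhdsWithin] with x h1 h2 hx
    rw [h1, Finset.sum_range_succ'] at h2
    have hx : x ≠ 0 := hx
    apply mul_left_cancel₀ hx
    rw [mul_add, Finset.mul_sum,
      Finset.sum_congr rfl fun k _ => show x * (a (k + 1) * x ^ k) = a (k + 1) * x ^ (k + 1) by ring]
    linear_combination h2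
  -- Division by `x` loses the point `0`; both sides are continuous there, so equality extends.
  have h0 : R 0 = ∑ k ∈ Finset.range K, a (k + 1) * 0 ^ k + 0 ^ K * S 0 := by
    refine tendsto_nhds_unique (l := 𝓝[≠] (0 : ℂ)) (hR.continuousAt.tendsto.mono_left nhdsWithin_le_nhds) ?_
    refine Tendsto.congr' (EventuallyEq.symm hne) ?_
    have : ContinuousAt (fun x : ℂ => ∑ k ∈ Finset.range K, a (k + 1) * x ^ k + x ^ K * S x) 0 := by
      have := hS.continuousAt
      fun_prop
    exact this.tendsto.mono_left nhdsWithin_le_nhds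
  rw [eventually_nhdsWithin_iff] at hne
  filter_upwards [hne] with x hx
  by_cases hx0 : x = 0
  · rw [hx0, h0]
  · exact hx hx0

/-- Induction on the order, peeling the constant term off `A` only: the Cauchy product of order `K +
1` splits into `a 0` times the expansion of `B` and `x` times the product of the tail of `A` with
`B`. -/
theorem mul (hA : HasTaylorCoeffs A a) (hB : HasTaylorCoeffs B b) :
    HasTaylorCoeffs (fun x => A x * B x)
      (fun k => ∑ ij ∈ Finset.HasAntidiagonal.antidiagonal k, a ij.1 * b ij.2) := by
  intro K
  induction K generalizing A a with
  | zero =>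
    obtain ⟨R, hR, h1⟩ := hA 0
    obtain ⟨S, hS, h2⟩ := hB 0
    refine ⟨fun x => R x * S x, hR.mul hS, ?_⟩
    filter_upwards [h1, h2] with x h1 h2
    simp [h1, h2]
  | succ K ih =>
    obtain ⟨A', hA', h1⟩ := hA.tail
    obtain ⟨R, hR, h2⟩ := ih hA'
    obtain ⟨S, hS, h3⟩ := hB (K + 1)
    refine ⟨fun x => a 0 * S x + R x, (hS.const_mul _).add hR, ?_⟩
    filter_upwards [h1, h2, h3] with x h1 h2 h3
    rw [h1, add_mul, mul_assoc, h2, h3, Finset.sum_range_succ', Finset.sum_range_succ' _ K]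
    simp only [Finset.Nat.sum_antidiagonal_succ, add_mul, Finset.sum_add_distrib,
      Finset.Nat.antidiagonal_zero, Finset.sum_singleton]
    have e : ∑ k ∈ Finset.range K, (∑ ij ∈ Finset.HasAntidiagonal.antidiagonal k, a (ij.1 + 1) * b ij.2) * x ^ (k + 1)
        = x * ∑ k ∈ Finset.range K, (∑ ij ∈ Finset.HasAntidiagonal.antidiagonal k, a (ij.1 + 1) * b ij.2) * x ^ k := by
      rw [Finset.mul_sum]; exact Finset.sum_congr rfl fun _ _ => by ring
    have e2 : ∑ k ∈ Finset.range K, a 0 * b (k + 1) * x ^ (k + 1)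
        = a 0 * ∑ k ∈ Finset.range K, b (k + 1) * x ^ (k + 1) := by
      rw [Finset.mul_sum]; exact Finset.sum_congr rfl fun _ _ => by ring
    rw [e, e2]
    ring

/-- The principal part of `A x / x ^ M`. -/
theorem exists_div_pow (hA : HasTaylorCoeffs A a) (M : ℕ) : ∃ R : ℂ → ℂ, DifferentiableAt ℂ R 0 ∧
    ∀ᶠ x in 𝓝[≠] (0 : ℂ), A x / x ^ M = ∑ k ∈ Finset.range M, a k / x ^ (M - k) + R x := by
  obtain ⟨R, hR, h⟩ := hA M
  refine ⟨R, hR, ?_⟩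
  filter_upwards [h.filter_mono nhdsWithin_le_nhds, self_mem_nhdsWithin] with x h hx
  have hx : x ≠ 0 := hx
  rw [h, add_div, Finset.sum_div, mul_div_cancel_left₀ _ (pow_ne_zero _ hx)]
  congr 1
  refine Finset.sum_congr rfl fun k hk => ?_
  rw [Finset.mem_range] at hk
  rw [div_eq_div_iff (pow_ne_zero _ hx) (pow_ne_zero _ hx), mul_assoc, ← pow_add]
  congr 2
  omega

/-- The expansion of `1 / (z + x) ^ (q + 1)`. -/
theorem one_div_add_pow (q : ℕ) {z : ℂ} (hz : z ≠ 0) :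
    HasTaylorCoeffs (fun x => 1 / (z + x) ^ (q + 1))
      (fun k => (-1) ^ k * ((k + q).choose q : ℂ) * (1 / z ^ (k + q + 1))) := by
  have h := (of_hasFPowerSeriesAt
    (Complex.one_div_sub_pow_hasFPowerSeriesOnBall_zero q (neg_ne_zero.mpr hz)).hasFPowerSeriesAt)
  have h2 := h.const_mul ((-1) ^ (q + 1))
  convert h2 using 1
  · ext x
    have : (-z - x) ^ (q + 1) = (-1) ^ (q + 1) * (z + x) ^ (q + 1) := by
      rw [← mul_pow]; ring
    rw [this, one_div, one_div, mul_inv, ← mul_assoc, mul_inv_cancel₀, one_mul]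
    exact pow_ne_zero _ (by norm_num)
  · ext k
    rw [FormalMultilinearSeries.coeff_ofScalars, neg_pow z, mul_inv, ← inv_pow]
    have e : (-1 : ℂ)⁻¹ ^ (k + q + 1) = (-1) ^ (k + q + 1) := by norm_num
    rw [e, add_comm q k, one_div, show k + q + 1 = k + (q + 1) from rfl, pow_add]
    have : (-1 : ℂ) ^ (q + 1) * (-1) ^ (q + 1) = 1 := by rw [← mul_pow]; norm_num
    linear_combination -(-1) ^ k * ((k + q).choose q : ℂ) * (z ^ (k + (q + 1)))⁻¹ * this

end HasTaylorCoeffs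

end Taylor

/-! ### The digamma function as a limit, through Euler's product for `Γ`. -/

section Digamma

open Filter Topology Complex

/-- In Euler's integral `(1 - x/n)^n ≤ e^(-x)`. The bound does not depend on `n`, which is what
dominated convergence on a circle needs. -/
theorem norm_GammaSeq_le {s : ℂ} (hs : 0 < s.re) {n : ℕ} (hn : n ≠ 0) :
    ‖GammaSeq s n‖ ≤ Real.Gamma s.re := by
  rw [GammaSeq_eq_approx_Gamma_integral hs hn, Real.Gamma_eq_integral hs,
    intervalIntegral.integral_of_le (Nat.cast_nonneg n)]
  have hint := Real.GammaIntegral_convergent hs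
  refine (MeasureTheory.norm_integral_le_of_norm_le
    (hint.mono_set Set.Ioc_subset_Ioi_self) ?_).trans ?_
  · refine (MeasureTheory.ae_restrict_mem measurableSet_Ioc).mono fun x hx => ?_
    rw [norm_mul, norm_cpow_eq_rpow_re_of_pos hx.1, Complex.norm_real, sub_re, one_re]
    have h0 : 0 ≤ 1 - x / n := by
      rw [sub_nonneg, div_le_one (by positivity)]; exact hx.2
    rw [Real.norm_of_nonneg (pow_nonneg h0 n)]
    gcongr
    · exact Real.rpow_nonneg hx.1.le _
    · exact Real.one_sub_div_pow_le_exp_neg hx.2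
  · refine MeasureTheory.setIntegral_mono_set hint ?_ Set.Ioc_subset_Ioi_self.eventuallyLE
    refine (MeasureTheory.ae_restrict_mem measurableSet_Ioi).mono fun x hx => ?_
    exact mul_nonneg (Real.exp_pos _).le (Real.rpow_nonneg (le_of_lt hx) _)

theorem GammaSeq_differentiableAt {s : ℂ} (hs : ∀ j : ℕ, s ≠ -j) {n : ℕ} (hn : n ≠ 0) :
    DifferentiableAt ℂ (fun z => GammaSeq z n) s := by
  unfold GammaSeq
  refine DifferentiableAt.div ?_ ?_ ?_
  · have : (n : ℂ) ≠ 0 := Nat.cast_ne_zero.mpr hn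
    exact ((differentiableAt_id.const_cpow (Or.inl this))).mul_const _
  · fun_prop
  · exact Finset.prod_ne_zero_iff.mpr fun j _ h => hs j (eq_neg_of_add_eq_zero_left h)

theorem logDeriv_GammaSeq {s : ℂ} (hs : ∀ j : ℕ, s ≠ -j) {n : ℕ} (hn : n ≠ 0) :
    logDeriv (fun z => GammaSeq z n) s =
      Complex.log n - ∑ j ∈ Finset.range (n + 1), 1 / ((j : ℂ) + s) := by
  have hn' : (n : ℂ) ≠ 0 := Nat.cast_ne_zero.mpr hn
  have hne : ∀ j ∈ Finset.range (n + 1), s + (j : ℂ) ≠ 0 :=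
    fun j _ h => hs j (eq_neg_of_add_eq_zero_left h)
  have hpow : HasDerivAt (fun z : ℂ => (n : ℂ) ^ z) ((n : ℂ) ^ s * Complex.log n) s := by
    simpa using (hasDerivAt_id s).const_cpow (c := (n : ℂ)) (Or.inl hn')
  unfold GammaSeq
  rw [logDeriv_div s, logDeriv_mul_const, logDeriv_prod, logDeriv_apply, hpow.deriv]
  · rw [mul_div_cancel_left₀]
    · congr 1
      refine Finset.sum_congr rfl fun j _ => ?_
      rw [logDeriv_apply]
      simp [add_comm]
    · simp [hn']
  · exact fun j hj => hne j hj
  · intro j _; fun_prop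
  · exact mod_cast n.factorial_ne_zero
  · simp [hn', n.factorial_ne_zero]
  · exact Finset.prod_ne_zero_iff.mpr hne
  · exact hpow.differentiableAt.mul_const _
  · fun_prop

/-- Cauchy's formula writes both derivatives as circle integrals, so pointwise convergence with a
uniform bound suffices. The radius `s.re / 2` keeps the closed disc in the right half-plane. -/
theorem tendsto_deriv_GammaSeq {s : ℂ} (hs : 0 < s.re) :
    Tendsto (fun n : ℕ => deriv (fun z => GammaSeq z n) s) atTop (𝓝 (deriv Gamma s)) := by
  set r : ℝ := s.re / 2 with hr
  have hr0 : 0 < r := by positivity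
  have hre : ∀ z ∈ Metric.closedBall s r, 0 < z.re := by
    intro z hz
    have h1 : |(z - s).re| ≤ r := (abs_re_le_norm _).trans (by simpa [dist_eq_norm] using hz)
    rw [sub_re] at h1
    have := (abs_le.mp h1).1
    linarith
  have hne : ∀ z ∈ Metric.closedBall s r, ∀ j : ℕ, z ≠ -j := by
    intro z hz j h
    have := hre z hz
    rw [h] at this
    simp at this
    linarith [Nat.cast_nonneg (α := ℝ) j]
  obtain ⟨C, hC⟩ : ∃ C, ∀ z ∈ Metric.closedBall s r, Real.Gamma z.re ≤ C := by
    have hcont : ContinuousOn (fun z : ℂ => Real.Gamma z.re) (Metric.closedBall s r) := by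
      intro z hz
      refine ContinuousAt.continuousWithinAt ?_
      have h1 : ContinuousAt Real.Gamma z.re := by
        refine (Real.differentiableAt_Gamma fun m h => ?_).continuousAt
        have := hre z hz
        rw [h] at this
        linarith [Nat.cast_nonneg (α := ℝ) m]
      exact h1.comp continuous_re.continuousAt
    obtain ⟨C, hC⟩ := (isCompact_closedBall s r).bddAbove_image hcont
    exact ⟨C, fun z hz => hC ⟨z, hz, rfl⟩⟩
  have hGd : DifferentiableOn ℂ Gamma (Metric.closedBall s r) := fun z hz =>
    (differentiableAt_Gamma z (hne z hz)).differentiableWithinAt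
  have hSd : ∀ n : ℕ, n ≠ 0 → DifferentiableOn ℂ (fun z => GammaSeq z n) (Metric.closedBall s r) :=
    fun n hn z hz => (GammaSeq_differentiableAt (hne z hz) hn).differentiableWithinAt
  have h2 : (2 * Real.pi * I : ℂ) ≠ 0 := by simp [Real.pi_ne_zero]
  suffices h : Tendsto (fun n : ℕ => ∮ z in C(s, r), (1 / (z - s) ^ 2) • GammaSeq z n) atTop
      (𝓝 (∮ z in C(s, r), (1 / (z - s) ^ 2) • Gamma z)) by
    rw [hGd.deriv_eq_smul_circleIntegral hr0] at h
    have h3 := h.const_smul (2 * Real.pi * I : ℂ)⁻¹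
    rw [inv_smul_smul₀ h2] at h3
    refine h3.congr' ?_
    filter_upwards [eventually_ne_atTop 0] with n hn
    rw [(hSd n hn).deriv_eq_smul_circleIntegral hr0, inv_smul_smul₀ h2]
  have hmem : ∀ θ, circleMap s r θ ∈ Metric.closedBall s r := fun θ =>
    circleMap_mem_closedBall s hr0.le θ
  unfold circleIntegral
  refine intervalIntegral.tendsto_integral_filter_of_dominated_convergence
    (fun _ => r * ((1 / r ^ 2) * C)) ?_ ?_ ?_ ?_
  · filter_upwards [eventually_ne_atTop 0] with n hn
    refine Continuous.aestronglyMeasurable ?_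
    have hc : Continuous fun θ => GammaSeq (circleMap s r θ) n :=
      (hSd n hn).continuousOn.comp_continuous (continuous_circleMap s r) hmem
    have hc2 : Continuous fun θ => (1 / (circleMap s r θ - s) ^ 2) := by
      refine continuous_const.div (by fun_prop) fun θ => ?_
      exact pow_ne_zero _ (sub_ne_zero.mpr (circleMap_ne_center hr0.ne'))
    have hc3 : Continuous fun θ => deriv (circleMap s r) θ := by
      simp only [deriv_circleMap]; fun_prop
    exact hc3.smul (hc2.smul hc)
  · filter_upwards [eventually_ne_atTop 0] with n hn
    refine Eventually.of_forall fun θ _ => ?_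
    rw [norm_smul, norm_smul, deriv_circleMap, norm_mul, norm_I, mul_one, norm_circleMap_zero,
      abs_of_pos hr0, norm_div, norm_one, norm_pow]
    have : ‖circleMap s r θ - s‖ = r := by simp [circleMap, abs_of_pos hr0]
    rw [this]
    gcongr
    exact (norm_GammaSeq_le (hre _ (hmem θ)) hn).trans (hC _ (hmem θ))
  · simp
  · refine Eventually.of_forall fun θ _ => ?_
    exact ((GammaSeq_tendsto_Gamma _).const_smul _).const_smul _

theorem tendsto_genHarmonic_one_sub_log :
    Tendsto (fun n : ℕ => genHarmonic 1 (n + 1) - Complex.log n) atTop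
      (𝓝 (Real.eulerMascheroniConstant : ℂ)) := by
  have h1 := Real.tendsto_harmonic_sub_log
  have h2 : Tendsto (fun n : ℕ => (harmonic n : ℝ) - Real.log n + 1 / ((n : ℝ) + 1)) atTop
      (𝓝 (Real.eulerMascheroniConstant + 0)) := h1.add tendsto_one_div_add_atTop_nhds_zero_nat
  rw [add_zero] at h2
  have h3 := (continuous_ofReal.tendsto _).comp h2
  refine h3.congr fun n => ?_
  simp only [Function.comp, genHarmonic, ofReal_add, ofReal_sub, pow_one]
  rw [Finset.sum_Icc_succ_top (by omega), harmonic_eq_sum_Icc, natCast_log]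
  push_cast
  simp only [one_div]
  ring

/-- The digamma function as a limit of partial sums. -/
theorem tendsto_sum_one_div_sub_genHarmonic {s : ℂ} (hs : ∀ j : ℕ, s ≠ -j) :
    Tendsto (fun n : ℕ => ∑ j ∈ Finset.range (n + 1), 1 / ((j : ℂ) + s) - genHarmonic 1 (n + 1))
      atTop (𝓝 (-(digamma s + (Real.eulerMascheroniConstant : ℂ)))) := by
  -- The derivative argument needs `0 < s.re`. Other points are reached by induction on the number
  -- of unit shifts, using `ψ(s+1) = ψ(s) + 1/s`; the partial sums change by `1/s` and a boundary
  -- term tending to `0`.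
  have key : ∀ k : ℕ, ∀ s : ℂ, (∀ j : ℕ, s ≠ -j) → 0 < (s + k).re →
      Tendsto (fun n : ℕ => ∑ j ∈ Finset.range (n + 1), 1 / ((j : ℂ) + s) - genHarmonic 1 (n + 1))
        atTop (𝓝 (-(digamma s + (Real.eulerMascheroniConstant : ℂ)))) := by
    intro k
    induction k with
    | zero =>
      intro s hs hre
      rw [Nat.cast_zero, add_zero] at hre
      have h1 : Tendsto (fun n : ℕ => logDeriv (fun z => GammaSeq z n) s) atTop
          (𝓝 (digamma s)) := by
        simp only [logDeriv_apply, digamma_def]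
        exact (tendsto_deriv_GammaSeq hre).div (GammaSeq_tendsto_Gamma s) (Gamma_ne_zero hs)
      have h2 := (h1.add tendsto_genHarmonic_one_sub_log).neg
      refine h2.congr' ?_
      filter_upwards [eventually_ne_atTop 0] with n hn
      rw [logDeriv_GammaSeq hs hn]
      ring
    | succ k ih =>
      intro s hs hre
      have hs1 : ∀ j : ℕ, s + 1 ≠ -j := by
        intro j h
        apply hs (j + 1)
        push_cast
        linear_combination h
      have h1 := ih (s + 1) hs1 (by
        have : s + 1 + (k : ℂ) = s + ((k + 1 : ℕ) : ℂ) := by push_cast; ring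
        rwa [this])
      rw [digamma_apply_add_one s hs] at h1
      have h3 : Tendsto (fun n : ℕ => 1 / (((n : ℕ) : ℂ) + (s + 1))) atTop (𝓝 0) := by
        simp only [one_div]
        refine tendsto_inv₀_cobounded.comp ?_
        rw [← tendsto_norm_atTop_iff_cobounded]
        refine tendsto_atTop_mono (f := fun n : ℕ => (n : ℝ) - ‖s + 1‖) (fun n => ?_) ?_
        · simpa using norm_sub_le_norm_add (n : ℂ) (s + 1)
        · exact tendsto_atTop_add_const_right _ _ tendsto_natCast_atTop_atTop
      have h4 := (h1.add_const (1 / s)).sub h3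
      have e : -(digamma s + s⁻¹ + (Real.eulerMascheroniConstant : ℂ)) + 1 / s - 0
          = -(digamma s + (Real.eulerMascheroniConstant : ℂ)) := by rw [one_div]; ring
      rw [e] at h4
      refine h4.congr fun n => ?_
      rw [Finset.sum_range_succ, Finset.sum_range_succ' _ n]
      push_cast
      simp only [add_assoc, add_comm (1 : ℂ) s, zero_add]
      ring
  obtain ⟨k, hk⟩ := exists_nat_gt (-s.re)
  refine key k s hs ?_
  rw [add_re, natCast_re]
  linarith

end Digamma

/-! ### The truncated kernel and its partial fraction expansion. -/

section Truncation

open Filter Topology Finset.HasAntidiagonal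

/-- Partial sums of the Hurwitz zeta function, regularized at `q = 1`. -/
noncomputable def truncHurwitz (q N : ℕ) (s : ℂ) : ℂ :=
  ∑ i ∈ Finset.range (N + 1), 1 / ((i : ℂ) + s) ^ q - if q = 1 then genHarmonic 1 (N + 1) else 0

/-- Symmetric partial sums of the Mittag-Leffler expansion of `π cot (π s)`. -/
noncomputable def truncCot (N : ℕ) (s : ℂ) : ℂ :=
  ∑ i ∈ Finset.range (N + 1), 1 / ((i : ℂ) + s) + ∑ j ∈ Finset.Icc 1 N, 1 / (s - j)

/-- The regularized value of `∑_{i ≤ N, i ≠ n} 1 / (i - n) ^ q`. -/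
noncomputable def truncZeta (q N n : ℕ) : ℂ :=
  genHarmonic q (N - n) + (-1) ^ q * genHarmonic q n - if q = 1 then genHarmonic 1 (N + 1) else 0

/-- Taylor coefficients of the regular part of `truncHurwitz q N` at `-n`. -/
noncomputable def hurwitzCoeff (q N n k : ℕ) : ℂ :=
  (-1) ^ k * ((k + q - 1).choose (q - 1) : ℂ) * truncZeta (k + q) N n

/-- Taylor coefficients of `x * truncCot N (x - n)` at `0`. -/
noncomputable def cotCoeff (N n k : ℕ) : ℂ :=
  Nat.casesOn k 1 fun k =>
    (-1) ^ k * (genHarmonic (k + 1) (N - n) + (-1) ^ (k + 1) * genHarmonic (k + 1) (N + n))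

/-- The principal part at `0` of `(A x / x) * (1 / x ^ p + B x) * (1 / x ^ m + C x)` in terms of the
Taylor coefficients of `A`, `B` and `C`, where `A 0 = 1`. -/
noncomputable def principalPart (p m : ℕ) (α β γ : ℕ → ℂ) (x : ℂ) : ℂ :=
  ∑ k ∈ Finset.range (p + m + 1), α k / x ^ (p + m + 1 - k)
    + ∑ k ∈ Finset.range (m + 1), (∑ ij ∈ antidiagonal k, α ij.1 * β ij.2) / x ^ (m + 1 - k)
    + ∑ k ∈ Finset.range (p + 1), (∑ ij ∈ antidiagonal k, α ij.1 * γ ij.2) / x ^ (p + 1 - k)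
    + β 0 * γ 0 / x

theorem genHarmonic_eq_sum_range (q n : ℕ) :
    genHarmonic q n = ∑ k ∈ Finset.range n, 1 / ((k : ℂ) + 1) ^ q := by
  unfold genHarmonic
  rw [Finset.range_eq_Ico, Finset.sum_Ico_eq_sum_range, ← Finset.Ico_add_one_right_eq_Icc, Finset.sum_Ico_eq_sum_range]
  refine Finset.sum_congr rfl fun k _ => ?_
  push_cast
  simp [add_comm]

/-- The indices above `n` contribute the first harmonic number; those below, read backwards,
contribute the second with the sign `(-1)^q`. -/
theorem sum_erase_one_div_sub_pow {N n : ℕ} (h : n ≤ N) (q : ℕ) :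
    ∑ i ∈ (Finset.range (N + 1)).erase n, 1 / ((i : ℂ) - n) ^ q
      = genHarmonic q (N - n) + (-1) ^ q * genHarmonic q n := by
  obtain ⟨d, rfl⟩ := Nat.exists_eq_add_of_le h
  rw [Nat.add_sub_cancel_left]
  have hmem : n ∈ Finset.range (n + d + 1) := by simp
  rw [Finset.sum_erase_eq_sub hmem, show n + d + 1 = (n + 1) + d by ring, Finset.sum_range_add,
    Finset.sum_range_succ, genHarmonic_eq_sum_range, genHarmonic_eq_sum_range,
    ← Finset.sum_range_reflect (fun i : ℕ => 1 / ((i : ℂ) - n) ^ q) n, Finset.mul_sum]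
  have e1 : ∀ i ∈ Finset.range n, 1 / (((n - 1 - i : ℕ) : ℂ) - n) ^ q
      = (-1) ^ q * (1 / ((i : ℂ) + 1) ^ q) := by
    intro i hi
    rw [Finset.mem_range] at hi
    rw [Nat.sub_sub, Nat.cast_sub (by omega)]
    push_cast
    rw [show (n : ℂ) - (1 + i) - n = -(i + 1) by ring, neg_pow, one_div, mul_inv, ← inv_pow, one_div]
    norm_num
  have e2 : ∀ i ∈ Finset.range d, 1 / (((n + 1 + i : ℕ) : ℂ) - n) ^ q = 1 / ((i : ℂ) + 1) ^ q := by
    intro i _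
    push_cast
    congr 2
    ring
  rw [Finset.sum_congr rfl e1, Finset.sum_congr rfl e2]
  ring

theorem sum_Icc_one_div_neg_pow (N n q : ℕ) :
    ∑ j ∈ Finset.Icc 1 N, 1 / (-(n : ℂ) - j) ^ q
      = (-1) ^ q * (genHarmonic q (N + n) - genHarmonic q n) := by
  rw [add_comm N n, genHarmonic_eq_sum_range, genHarmonic_eq_sum_range, Finset.sum_range_add,
    add_sub_cancel_left, ← Finset.Ico_add_one_right_eq_Icc, Finset.sum_Ico_eq_sum_range,
    Finset.mul_sum, Nat.add_sub_cancel]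
  refine Finset.sum_congr rfl fun i _ => ?_
  push_cast
  rw [show -(n : ℂ) - (1 + i) = -(n + i + 1) by ring, neg_pow, one_div, mul_inv, ← inv_pow, one_div]
  norm_num

/-- Only the summand `i = n` is singular at `-n`; every other one expands about `i - n ≠ 0`. The
regularizing constant affects the coefficient of index `0` alone. -/
theorem truncHurwitz_hasTaylorCoeffs {N n : ℕ} (h : n ≤ N) {q : ℕ} (hq : 1 ≤ q) :
    HasTaylorCoeffs (fun x => truncHurwitz q N (x - n) - 1 / x ^ q) (hurwitzCoeff q N n) := by
  obtain ⟨q, rfl⟩ := Nat.exists_eq_add_of_le' hq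
  have hmem : n ∈ Finset.range (N + 1) := by simp; omega
  have h1 := HasTaylorCoeffs.sum ((Finset.range (N + 1)).erase n)
    (A := fun i x => 1 / (((i : ℂ) - n) + x) ^ (q + 1)) (fun i hi =>
      HasTaylorCoeffs.one_div_add_pow q (z := (i : ℂ) - n) (by
        rw [Finset.mem_erase] at hi
        rw [sub_ne_zero]
        exact mod_cast hi.1))
  have h2 := h1.add (HasTaylorCoeffs.zero.cons (-(if q + 1 = 1 then genHarmonic 1 (N + 1) else 0)))
  convert h2 using 1
  · ext x
    rw [truncHurwitz, ← Finset.add_sum_erase _ _ hmem]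
    have : ∀ i : ℕ, (i : ℂ) + (x - n) = (i : ℂ) - n + x := fun i => by ring
    simp only [this]
    rw [sub_self, zero_add]
    ring
  · ext k
    rw [← Finset.mul_sum, sum_erase_one_div_sub_pow h, hurwitzCoeff, truncZeta]
    cases k with
    | zero => simp [sub_eq_add_neg]
    | succ k =>
      have : ¬ (k + 1 + (q + 1) = 1) := by omega
      rw [if_neg this, sub_zero, add_zero, Nat.add_sub_cancel, show k + 1 + (q + 1) - 1 = k + 1 + q by omega]
      rfl

theorem truncCot_hasTaylorCoeffs {N n : ℕ} (h : n ≤ N) :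
    HasTaylorCoeffs (fun x => 1 + x * (truncCot N (x - n) - 1 / x)) (cotCoeff N n) := by
  have hmem : n ∈ Finset.range (N + 1) := by simp; omega
  have h1 := HasTaylorCoeffs.sum ((Finset.range (N + 1)).erase n)
    (A := fun i x => 1 / (((i : ℂ) - n) + x) ^ (0 + 1)) (fun i hi =>
      HasTaylorCoeffs.one_div_add_pow 0 (z := (i : ℂ) - n) (by
        rw [Finset.mem_erase] at hi
        rw [sub_ne_zero]
        exact mod_cast hi.1))
  have h2 := HasTaylorCoeffs.sum (Finset.Icc 1 N)
    (A := fun j x => 1 / ((-(n : ℂ) - j) + x) ^ (0 + 1)) (fun j hj =>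
      HasTaylorCoeffs.one_div_add_pow 0 (z := -(n : ℂ) - j) (by
        rw [Finset.mem_Icc] at hj
        rw [← neg_add', neg_ne_zero]
        exact_mod_cast (by omega : n + j ≠ 0)))
  have h3 := (h1.add h2).cons 1
  convert h3 using 1
  · ext x
    rw [truncCot, ← Finset.add_sum_erase _ _ hmem]
    have e1 : ∀ i : ℕ, (i : ℂ) + (x - n) = (i : ℂ) - n + x := fun i => by ring
    have e2 : ∀ j : ℕ, x - (n : ℂ) - j = -(n : ℂ) - j + x := fun j => by ring
    simp only [e1, e2]
    rw [sub_self, zero_add]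
    simp only [zero_add, pow_one]
    ring
  · ext k
    cases k with
    | zero => rfl
    | succ k =>
      simp only [cotCoeff]
      rw [← Finset.mul_sum, ← Finset.mul_sum, sum_erase_one_div_sub_pow h, sum_Icc_one_div_neg_pow]
      simp only [add_zero, Nat.choose_zero_right, Nat.cast_one]
      ring

/-- Multiplying out gives four quotients, with denominators `x^(p+m+1)`, `x^(m+1)`, `x^(p+1)` and
`x`. In the last one only the residue survives, and `h0` reduces it to `β 0 * γ 0`. -/
theorem exists_principalPart {p m : ℕ} {A B C : ℂ → ℂ} {α β γ : ℕ → ℂ} (hA : HasTaylorCoeffs A α)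
    (hB : HasTaylorCoeffs B β) (hC : HasTaylorCoeffs C γ) (h0 : α 0 = 1) :
    ∃ R : ℂ → ℂ, DifferentiableAt ℂ R 0 ∧ ∀ᶠ x in 𝓝[≠] (0 : ℂ),
      A x / x * (1 / x ^ p + B x) * (1 / x ^ m + C x) = principalPart p m α β γ x + R x := by
  obtain ⟨R1, hR1, h1⟩ := hA.exists_div_pow (p + m + 1)
  obtain ⟨R2, hR2, h2⟩ := (hA.mul hB).exists_div_pow (m + 1)
  obtain ⟨R3, hR3, h3⟩ := (hA.mul hC).exists_div_pow (p + 1)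
  obtain ⟨R4, hR4, h4⟩ := ((hA.mul hB).mul hC).exists_div_pow 1
  refine ⟨fun x => R1 x + R2 x + R3 x + R4 x, ((hR1.add hR2).add hR3).add hR4, ?_⟩
  filter_upwards [h1, h2, h3, h4, self_mem_nhdsWithin] with x h1 h2 h3 h4 hx
  have hx : x ≠ 0 := hx
  have e : A x / x * (1 / x ^ p + B x) * (1 / x ^ m + C x) = A x / x ^ (p + m + 1)
      + A x * B x / x ^ (m + 1) + A x * C x / x ^ (p + 1) + A x * B x * C x / x ^ 1 := by
    field_simp
    ring
  rw [e, h1, h2, h3, h4, principalPart]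
  simp [h0]
  ring

theorem tendsto_one_div_add_pow_cocompact (c : ℂ) {k : ℕ} (hk : k ≠ 0) :
    Tendsto (fun s : ℂ => 1 / (s + c) ^ k) (cocompact ℂ) (𝓝 0) := by
  have h1 : Tendsto (fun s : ℂ => s + c) (cocompact ℂ) (cocompact ℂ) :=
    (Homeomorph.addRight c).isClosedEmbedding.tendsto_cocompact
  have h2 : Tendsto (fun s : ℂ => (s + c)⁻¹) (cocompact ℂ) (𝓝 0) :=
    (tendsto_inv₀_cobounded (α := ℂ)).comp (by simpa [Metric.cobounded_eq_cocompact] using h1)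
  have h3 := h2.pow k
  rw [zero_pow hk] at h3
  exact h3.congr fun s => by rw [one_div, inv_pow]

theorem tendsto_truncCot_cocompact (N : ℕ) : Tendsto (truncCot N) (cocompact ℂ) (𝓝 0) := by
  have h1 : ∀ i ∈ Finset.range (N + 1), Tendsto (fun s : ℂ => 1 / ((i : ℂ) + s)) (cocompact ℂ) (𝓝 0) :=
    fun i _ => by simpa [add_comm] using tendsto_one_div_add_pow_cocompact i one_ne_zero
  have h2 : ∀ j ∈ Finset.Icc 1 N, Tendsto (fun s : ℂ => 1 / (s - (j : ℂ))) (cocompact ℂ) (𝓝 0) :=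
    fun j _ => by simpa [sub_eq_add_neg] using tendsto_one_div_add_pow_cocompact (-(j : ℂ)) one_ne_zero
  unfold truncCot
  simpa using (tendsto_finsetSum _ h1).add (tendsto_finsetSum _ h2)

theorem tendsto_truncHurwitz_cocompact (q N : ℕ) (hq : q ≠ 0) :
    Tendsto (truncHurwitz q N) (cocompact ℂ)
      (𝓝 (0 - if q = 1 then genHarmonic 1 (N + 1) else 0)) := by
  have h1 : ∀ i ∈ Finset.range (N + 1),
      Tendsto (fun s : ℂ => 1 / ((i : ℂ) + s) ^ q) (cocompact ℂ) (𝓝 0) :=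
    fun i _ => by simpa [add_comm] using tendsto_one_div_add_pow_cocompact i hq
  have := (tendsto_finsetSum _ h1).sub_const (if q = 1 then genHarmonic 1 (N + 1) else 0)
  unfold truncHurwitz
  simpa using this

theorem differentiableAt_truncHurwitz (q N : ℕ) {s : ℂ} (hs : ∀ i ∈ Finset.range (N + 1), s ≠ -i) :
    DifferentiableAt ℂ (truncHurwitz q N) s := by
  unfold truncHurwitz
  refine DifferentiableAt.sub_const ?_ _
  refine DifferentiableAt.fun_sum fun i hi => ?_
  refine (differentiableAt_const _).div (by fun_prop) (pow_ne_zero _ ?_)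
  rw [add_comm]
  exact fun h => hs i hi (eq_neg_of_add_eq_zero_left h)

theorem differentiableAt_sum_one_div_add (N : ℕ) {s : ℂ}
    (hs : ∀ i ∈ Finset.range (N + 1), s ≠ -i) :
    DifferentiableAt ℂ (fun s : ℂ => ∑ i ∈ Finset.range (N + 1), 1 / ((i : ℂ) + s)) s := by
  refine DifferentiableAt.fun_sum fun i hi => ?_
  refine (differentiableAt_const _).div (by fun_prop) ?_
  rw [add_comm]
  exact fun h => hs i hi (eq_neg_of_add_eq_zero_left h)

theorem differentiableAt_sum_one_div_sub (S : Finset ℕ) {s : ℂ} (hs : ∀ j ∈ S, s ≠ j) :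
    DifferentiableAt ℂ (fun s : ℂ => ∑ j ∈ S, 1 / (s - j)) s := by
  refine DifferentiableAt.fun_sum fun j hj => ?_
  exact (differentiableAt_const _).div (by fun_prop) (sub_ne_zero.mpr (hs j hj))

theorem differentiableAt_principalPart (p m : ℕ) (α β γ : ℕ → ℂ) {x : ℂ} (hx : x ≠ 0) :
    DifferentiableAt ℂ (principalPart p m α β γ) x := by
  have h : ∀ (c : ℂ) (k : ℕ), DifferentiableAt ℂ (fun x : ℂ => c / x ^ k) x := fun c k =>
    (differentiableAt_const _).div (by fun_prop) (pow_ne_zero _ hx)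
  unfold principalPart
  refine DifferentiableAt.add (DifferentiableAt.add (DifferentiableAt.add ?_ ?_) ?_) ?_
  · exact DifferentiableAt.fun_sum fun k _ => h _ _
  · exact DifferentiableAt.fun_sum fun k _ => h _ _
  · exact DifferentiableAt.fun_sum fun k _ => h _ _
  · simpa using h (β 0 * γ 0) 1

theorem tendsto_principalPart_cocompact (p m : ℕ) (α β γ : ℕ → ℂ) :
    Tendsto (principalPart p m α β γ) (cocompact ℂ) (𝓝 0) := by
  have h : ∀ (c : ℂ) (k : ℕ), k ≠ 0 → Tendsto (fun x : ℂ => c / x ^ k) (cocompact ℂ) (𝓝 0) := by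
    intro c k hk
    simpa [div_eq_mul_inv] using (tendsto_one_div_add_pow_cocompact 0 hk).const_mul c
  have hs : ∀ (M : ℕ) (c : ℕ → ℂ), Tendsto (fun x : ℂ => ∑ k ∈ Finset.range M, c k / x ^ (M - k))
      (cocompact ℂ) (𝓝 0) := by
    intro M c
    rw [← Finset.sum_const_zero (s := Finset.range M)]
    refine tendsto_finsetSum _ fun k hk => h _ _ ?_
    rw [Finset.mem_range] at hk
    omega
  have h4 := h (β 0 * γ 0) 1 one_ne_zero
  simp only [pow_one] at h4
  unfold principalPart
  simpa using (((hs (p + m + 1) _).add (hs (m + 1) _)).add (hs (p + 1) _)).add h4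

/-- The partial fraction expansion of a product of truncated Mittag-Leffler expansions. -/
theorem truncCot_mul_truncHurwitz_mul {p m : ℕ} (hp : 1 ≤ p) (hm : 1 ≤ m) (N : ℕ) {s : ℂ}
    (hs : ∀ n : ℤ, s ≠ n) :
    truncCot N s * truncHurwitz p N s * truncHurwitz m N s =
      ∑ n ∈ Finset.range (N + 1),
        principalPart p m (cotCoeff N n) (hurwitzCoeff p N n) (hurwitzCoeff m N n) (s + n)
      + ∑ j ∈ Finset.Icc 1 N, truncHurwitz p N j * truncHurwitz m N j / (s - j) := by
  set P : Finset (ℕ ⊕ ℕ) := (Finset.range (N + 1)).disjSum (Finset.Icc 1 N) with hP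
  set c : ℕ ⊕ ℕ → ℂ := Sum.elim (fun n => -(n : ℂ)) (fun j => (j : ℂ)) with hcdef
  set g : ℕ ⊕ ℕ → ℂ → ℂ := Sum.elim
    (fun n s => principalPart p m (cotCoeff N n) (hurwitzCoeff p N n) (hurwitzCoeff m N n) (s + n))
    (fun j s => truncHurwitz p N j * truncHurwitz m N j / (s - j)) with hg
  have key := eq_sum_principalParts P c ?_
    (fun s => truncCot N s * truncHurwitz p N s * truncHurwitz m N s) g ?_ ?_ ?_ ?_ ?_ s ?_
  · rw [hP, Finset.sum_disjSum] at key
    exact key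
  · rintro (a | a) ha (b | b) hb hab
    · simpa [hcdef] using hab
    · exfalso
      simp only [hP, Finset.mem_coe, Finset.inl_mem_disjSum, Finset.inr_mem_disjSum, Finset.mem_Icc,
        hcdef, Sum.elim_inl, Sum.elim_inr] at ha hb hab
      rw [neg_eq_iff_add_eq_zero] at hab
      norm_cast at hab
      omega
    · exfalso
      simp only [hP, Finset.mem_coe, Finset.inl_mem_disjSum, Finset.inr_mem_disjSum, Finset.mem_Icc,
        hcdef, Sum.elim_inl, Sum.elim_inr] at ha hb hab
      rw [eq_neg_iff_add_eq_zero] at hab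
      norm_cast at hab
      omega
    · simpa [hcdef] using hab
  · rintro (n | j) _ z hz
    · simp only [hg, hcdef, Sum.elim_inl] at hz ⊢
      have h1 : z + n ≠ 0 := fun h => hz (eq_neg_of_add_eq_zero_left h)
      exact (differentiableAt_principalPart p m _ _ _ h1).comp z (f := fun z : ℂ => z + (n : ℂ))
        (by fun_prop)
    · simp only [hg, hcdef, Sum.elim_inr] at hz ⊢
      exact (differentiableAt_const _).div (by fun_prop) (sub_ne_zero.mpr hz)
  · rintro (n | j) _
    · simp only [hg, Sum.elim_inl]
      exact (tendsto_principalPart_cocompact p m _ _ _).comp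
        (Homeomorph.addRight (n : ℂ)).isClosedEmbedding.tendsto_cocompact
    · simp only [hg, Sum.elim_inr]
      simpa [div_eq_mul_inv, sub_eq_add_neg] using (tendsto_one_div_add_pow_cocompact (-(j : ℂ))
        one_ne_zero).const_mul (truncHurwitz p N j * truncHurwitz m N j)
  · intro z hz
    have h1 : ∀ i ∈ Finset.range (N + 1), z ≠ -i := fun i hi =>
      hz (Sum.inl i) (by rw [hP]; exact Finset.inl_mem_disjSum.mpr hi)
    have h2 : ∀ j ∈ Finset.Icc 1 N, z ≠ j := fun j hj =>
      hz (Sum.inr j) (by rw [hP]; exact Finset.inr_mem_disjSum.mpr hj)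
    exact (((differentiableAt_sum_one_div_add N h1).add (differentiableAt_sum_one_div_sub _ h2)).mul
      (differentiableAt_truncHurwitz p N h1)).mul (differentiableAt_truncHurwitz m N h1)
  -- The Hurwitz factors may have nonzero limits when `p` or `m` is `1`; the decay of the cotangent
  -- factor makes the product vanish.
  · simpa using ((tendsto_truncCot_cocompact N).mul (tendsto_truncHurwitz_cocompact p N (by omega))).mul
      (tendsto_truncHurwitz_cocompact m N (by omega))
  · rintro (n | j) hi
    · rw [hP, Finset.inl_mem_disjSum, Finset.mem_range] at hi
      have hn : n ≤ N := by omega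
      obtain ⟨R, hR, h⟩ := exists_principalPart (p := p) (m := m) (truncCot_hasTaylorCoeffs hn)
        (truncHurwitz_hasTaylorCoeffs hn hp) (truncHurwitz_hasTaylorCoeffs hn hm) rfl
      simp only [hg, hcdef, Sum.elim_inl]
      refine ⟨fun z => R (z + n), ?_, ?_⟩
      · have hR' : DifferentiableAt ℂ R (-(n : ℂ) + n) := by simpa using hR
        exact hR'.comp (-(n : ℂ)) (f := fun z : ℂ => z + (n : ℂ)) (by fun_prop)
      · have ht : Tendsto (fun z : ℂ => z + n) (𝓝[≠] (-(n : ℂ))) (𝓝[≠] 0) := by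
          refine tendsto_nhdsWithin_iff.mpr ⟨?_, ?_⟩
          · have : Tendsto (fun z : ℂ => z + n) (𝓝 (-(n : ℂ))) (𝓝 (-(n : ℂ) + n)) := by
              exact (continuous_id.add continuous_const).tendsto _
            rw [neg_add_cancel] at this
            exact this.mono_left nhdsWithin_le_nhds
          · filter_upwards [self_mem_nhdsWithin] with z hz h
            exact hz (eq_neg_of_add_eq_zero_left h)
        filter_upwards [ht.eventually h, self_mem_nhdsWithin] with z hz hzn
        have hzn : z + n ≠ 0 := fun h => hzn (eq_neg_of_add_eq_zero_left h)
        rw [← hz]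
        simp only [add_sub_cancel_right, add_sub_cancel]
        rw [mul_sub, mul_one_div_cancel hzn, add_sub_cancel, mul_div_cancel_left₀ _ hzn]
    · rw [hP, Finset.inr_mem_disjSum] at hi
      have hj1 : 1 ≤ j := (Finset.mem_Icc.mp hi).1
      simp only [hg, hcdef, Sum.elim_inr]
      have hne : ∀ i ∈ Finset.range (N + 1), (j : ℂ) ≠ -i := by
        intro i _ h
        rw [eq_neg_iff_add_eq_zero] at h
        norm_cast at h
        omega
      set Z : ℂ → ℂ := fun z => truncHurwitz p N z * truncHurwitz m N z with hZ
      have hZd : ∀ᶠ z in 𝓝 (j : ℂ), DifferentiableAt ℂ Z z := by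
        have : ∀ᶠ z in 𝓝 (j : ℂ), ∀ i ∈ Finset.range (N + 1), z ≠ -(i : ℂ) := by
          rw [Filter.eventually_all_finset]
          exact fun i hi => isOpen_ne.mem_nhds (hne i hi)
        filter_upwards [this] with z hz
        exact (differentiableAt_truncHurwitz p N hz).mul (differentiableAt_truncHurwitz m N hz)
      have hZa : AnalyticAt ℂ Z j := Complex.analyticAt_iff_eventually_differentiableAt.mpr hZd
      obtain ⟨q, hq⟩ := hZa
      -- The singular summand `1/(z - j)` times `Z z` leaves `Z j / (z - j)` plus the divided slope
      -- of `Z`; all other summands of the cotangent are regular at `j`.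
      refine ⟨fun z => dslope Z j z + (∑ i ∈ Finset.range (N + 1), 1 / ((i : ℂ) + z)
        + ∑ k ∈ (Finset.Icc 1 N).erase j, 1 / (z - k)) * Z z, ?_, ?_⟩
      · refine hq.has_fpower_series_dslope_fslope.differentiableAt.add
          (((differentiableAt_sum_one_div_add N hne).add
            (differentiableAt_sum_one_div_sub _ fun k hk => ?_)).mul hq.differentiableAt)
        rw [Finset.mem_erase] at hk
        exact_mod_cast hk.1.symm
      · filter_upwards [self_mem_nhdsWithin] with z hz
        have hz : z ≠ j := hz
        have hzj : z - j ≠ 0 := sub_ne_zero.mpr hz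
        rw [dslope_of_ne _ hz, slope_def_field, mul_assoc, truncCot, ← Finset.add_sum_erase _ _ hi]
        change (_ + _) * Z z = Z j / _ + _
        field_simp
        ring
  · rintro (n | j) _
    · simpa [hcdef] using hs (-(n : ℤ))
    · simpa [hcdef] using hs j

end Truncation

/-! ### Pointwise limits as `N → ∞`. -/

section Limits

open Filter Topology

theorem tendsto_genHarmonic {q : ℕ} (hq : 2 ≤ q) :
    Tendsto (genHarmonic q) atTop (𝓝 (zetaNat q)) := by
  have h0 : q ≠ 0 := by omega
  have h1 : q ≠ 1 := by omega
  have hs : Summable (fun n : ℕ => 1 / ((n : ℂ) + 1) ^ q) := by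
    simpa using summable_hurwitzNat q hq 1
  have hz : zetaNat q = ∑' n : ℕ, 1 / ((n : ℂ) + 1) ^ q := by
    rw [zetaNat, if_neg h0, if_neg h1, zeta_nat_eq_tsum_of_gt_one (by omega),
      (Summable.tsum_eq_zero_add (by simpa using summable_hurwitzNat q hq 0))]
    simp [h0]
  rw [hz]
  exact hs.hasSum.tendsto_sum_nat.congr fun n => (genHarmonic_eq_sum_range q n).symm

theorem genHarmonic_succ (q n : ℕ) :
    genHarmonic q (n + 1) = genHarmonic q n + 1 / ((n : ℂ) + 1) ^ q := by
  simp only [genHarmonic_eq_sum_range, Finset.sum_range_succ]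

theorem genHarmonic_add (q a b : ℕ) :
    genHarmonic q (a + b) = genHarmonic q a + ∑ k ∈ Finset.range b, 1 / (((a + k : ℕ) : ℂ) + 1) ^ q := by
  simp only [genHarmonic_eq_sum_range, Finset.sum_range_add]

/-- Shifting the cutoff by a fixed amount is harmless. Hence the regularized sums at `q = 1` leave
no constant behind, as the convention `ζ(1) = 0` requires. -/
theorem tendsto_genHarmonic_one_add_sub (k : ℕ) :
    Tendsto (fun N => genHarmonic 1 (N + k) - genHarmonic 1 N) atTop (𝓝 0) := by
  induction k with
  | zero => simp
  | succ k ih =>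
    have h1 : Tendsto (fun N : ℕ => 1 / (((N + k : ℕ) : ℂ) + 1)) atTop (𝓝 0) :=
      (tendsto_one_div_add_atTop_nhds_zero_nat (𝕜 := ℂ)).comp (tendsto_add_atTop_nat k)
    have h2 := ih.add h1
    rw [add_zero] at h2
    refine h2.congr fun N => ?_
    rw [← add_assoc, genHarmonic_succ, pow_one]
    ring

theorem tendsto_truncCot {s : ℂ} (hs : ∀ n : ℤ, s ≠ n) :
    Tendsto (fun N => truncCot N s) atTop (𝓝 (Real.pi * Complex.cot (Real.pi * s))) := by
  have hmem : s ∈ Complex.integerComplement := by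
    rw [Complex.mem_integerComplement_iff]
    rintro ⟨n, hn⟩
    exact hs n hn.symm
  have h := (tendsto_logDeriv_euler_cot_sub hmem).add_const (1 / s)
  rw [sub_add_cancel] at h
  refine h.congr fun N => ?_
  rw [truncCot, Finset.sum_range_succ', ← Finset.Ico_add_one_right_eq_Icc,
    Finset.sum_Ico_eq_sum_range, Nat.add_sub_cancel]
  simp only [cotTerm, Finset.sum_add_distrib]
  push_cast
  simp only [add_comm]
  ring

theorem tendsto_truncHurwitz (q : ℕ) (hq : 1 ≤ q) {s : ℂ} (hs : ∀ n : ℤ, s ≠ n) :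
    Tendsto (fun N => truncHurwitz q N s) atTop (𝓝 (hurwitzNat q s)) := by
  unfold truncHurwitz hurwitzNat
  by_cases h : q = 1
  · subst h
    simp only [if_true, pow_one]
    exact tendsto_sum_one_div_sub_genHarmonic fun j => by simpa using hs (-(j : ℤ))
  · simp only [if_neg h, sub_zero]
    exact (summable_hurwitzNat q (by omega) s).hasSum.tendsto_sum_nat.comp (tendsto_add_atTop_nat 1)

theorem tendsto_truncZeta {q : ℕ} (hq : 1 ≤ q) (n : ℕ) :
    Tendsto (fun N => truncZeta q N n) atTop (𝓝 (zetaNat q + (-1) ^ q * genHarmonic q n)) := by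
  unfold truncZeta
  by_cases h : q = 1
  · subst h
    have h1 := ((tendsto_genHarmonic_one_add_sub (n + 1)).comp (tendsto_sub_atTop_nat n)).neg
    have h2 := h1.add_const ((-1) ^ 1 * genHarmonic 1 n)
    have e : zetaNat 1 + (-1) ^ 1 * genHarmonic 1 n = -0 + (-1) ^ 1 * genHarmonic 1 n := by
      simp [zetaNat]
    rw [e]
    refine h2.congr' ?_
    filter_upwards [eventually_ge_atTop n] with N hN
    simp only [Function.comp, if_true]
    rw [show N - n + (n + 1) = N + 1 by omega]
    ring
  · simp only [if_neg h, sub_zero]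
    exact ((tendsto_genHarmonic (by omega)).comp (tendsto_sub_atTop_nat n)).add_const _

theorem truncHurwitz_natCast_add_one (q N n : ℕ) :
    truncHurwitz q N ((n + 1 : ℕ) : ℂ) =
      genHarmonic q (n + (N + 1)) - genHarmonic q n - if q = 1 then genHarmonic 1 (N + 1) else 0 := by
  rw [truncHurwitz, genHarmonic_add q n, add_sub_cancel_left]
  congr 1
  refine Finset.sum_congr rfl fun i _ => ?_
  push_cast
  congr 2
  ring

theorem tendsto_truncHurwitz_natCast {q : ℕ} (hq : 1 ≤ q) (n : ℕ) :
    Tendsto (fun N => truncHurwitz q N ((n + 1 : ℕ) : ℂ)) atTop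
      (𝓝 (zetaNat q - genHarmonic q n)) := by
  simp only [truncHurwitz_natCast_add_one]
  by_cases h : q = 1
  · subst h
    have h1 := ((tendsto_genHarmonic_one_add_sub n).comp (tendsto_add_atTop_nat 1)).sub_const
      (genHarmonic 1 n)
    have e : zetaNat 1 = 0 := by simp [zetaNat]
    rw [e]
    refine h1.congr fun N => ?_
    simp only [Function.comp, if_true]
    rw [add_comm n (N + 1)]
    ring
  · simp only [if_neg h, sub_zero]
    refine ((tendsto_genHarmonic (by omega)).comp ?_).sub_const _
    exact tendsto_atTop_mono (fun N => show N ≤ n + (N + 1) by omega) tendsto_id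

/-- The Taylor coefficients at `0` of `π x cot (π x)`. -/
noncomputable def cotCoeffLim (k : ℕ) : ℂ := if Even k then -2 * zetaNat k else 0

/-- The two halves of the symmetric sum reinforce each other for even `k` and cancel for odd `k`. At
`k = 1` they cancel only as a difference of divergent harmonic numbers; at `k = 0` the value `1`
matches `ζ(0) = -1/2`. -/
theorem tendsto_cotCoeff (n k : ℕ) :
    Tendsto (fun N => cotCoeff N n k) atTop (𝓝 (cotCoeffLim k)) := by
  rcases k with _ | _ | k
  · simp [cotCoeff, cotCoeffLim, zetaNat]
    norm_num
  · have h1 := ((tendsto_genHarmonic_one_add_sub (2 * n)).comp (tendsto_sub_atTop_nat n)).neg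
    have e : cotCoeffLim (0 + 1) = -0 := by simp [cotCoeffLim]
    rw [e]
    refine h1.congr' ?_
    filter_upwards [eventually_ge_atTop n] with N hN
    simp only [Function.comp, cotCoeff]
    rw [show N - n + 2 * n = N + n by omega]
    ring
  · simp only [cotCoeff]
    have h1 := (tendsto_genHarmonic (q := k + 1 + 1) (by omega)).comp (tendsto_sub_atTop_nat n)
    have h2 := (tendsto_genHarmonic (q := k + 1 + 1) (by omega)).comp (tendsto_add_atTop_nat n)
    have h3 := (h1.add (h2.const_mul ((-1) ^ (k + 1 + 1)))).const_mul ((-1) ^ (k + 1))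
    refine h3.trans_eq (congrArg 𝓝 ?_)
    unfold cotCoeffLim
    rcases Nat.even_or_odd (k + 1 + 1) with he | ho
    · have ho : Odd (k + 1) := by
        rw [Nat.even_add_one, Nat.not_even_iff_odd] at he; exact he
      rw [if_pos he, he.neg_one_pow, ho.neg_one_pow]
      ring
    · rw [if_neg (Nat.not_even_iff_odd.mpr ho), ho.neg_one_pow]
      ring

end Limits

/-! ### Bounds uniform in `N`, and dominated convergence. -/

section Dominated

open Filter Topology

/-- `κ N n → κ' n` as `N → ∞`, with a uniform bound of order `(n + 1) ^ r` for `n ≤ N`. -/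
def DominatedLimit (r : ℝ) (κ : ℕ → ℕ → ℂ) (κ' : ℕ → ℂ) : Prop :=
  (∀ n, Tendsto (fun N => κ N n) atTop (𝓝 (κ' n))) ∧
    ∃ C : ℝ, ∀ N n, n ≤ N → ‖κ N n‖ ≤ C * ((n : ℝ) + 1) ^ r

namespace DominatedLimit

variable {r s : ℝ} {κ μ : ℕ → ℕ → ℂ} {κ' μ' : ℕ → ℂ}

theorem nonneg_const {C : ℝ} (h : ∀ N n, n ≤ N → ‖κ N n‖ ≤ C * ((n : ℝ) + 1) ^ r) : 0 ≤ C := by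
  have := (norm_nonneg _).trans (h 0 0 le_rfl)
  simpa using this

theorem mul (h1 : DominatedLimit r κ κ') (h2 : DominatedLimit s μ μ') :
    DominatedLimit (r + s) (fun N n => κ N n * μ N n) (fun n => κ' n * μ' n) := by
  obtain ⟨h1, C, hC⟩ := h1
  obtain ⟨h2, D, hD⟩ := h2
  refine ⟨fun n => (h1 n).mul (h2 n), C * D, fun N n hn => ?_⟩
  rw [norm_mul, Real.rpow_add (by positivity)]
  calc _ ≤ (C * ((n : ℝ) + 1) ^ r) * (D * ((n : ℝ) + 1) ^ s) :=
        mul_le_mul (hC N n hn) (hD N n hn) (norm_nonneg _)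
          (mul_nonneg (nonneg_const hC) (by positivity))
    _ = _ := by ring

theorem add (h1 : DominatedLimit r κ κ') (h2 : DominatedLimit r μ μ') :
    DominatedLimit r (fun N n => κ N n + μ N n) (fun n => κ' n + μ' n) := by
  obtain ⟨h1, C, hC⟩ := h1
  obtain ⟨h2, D, hD⟩ := h2
  refine ⟨fun n => (h1 n).add (h2 n), C + D, fun N n hn => ?_⟩
  rw [add_mul]
  exact (norm_add_le _ _).trans (add_le_add (hC N n hn) (hD N n hn))

theorem const_mul (c : ℂ) (h1 : DominatedLimit r κ κ') :
    DominatedLimit r (fun N n => c * κ N n) (fun n => c * κ' n) := by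
  obtain ⟨h1, C, hC⟩ := h1
  refine ⟨fun n => (h1 n).const_mul c, ‖c‖ * C, fun N n hn => ?_⟩
  rw [norm_mul, mul_assoc]
  exact mul_le_mul_of_nonneg_left (hC N n hn) (norm_nonneg _)

theorem mono (h1 : DominatedLimit r κ κ') (hrs : r ≤ s) : DominatedLimit s κ κ' := by
  obtain ⟨h1, C, hC⟩ := h1
  refine ⟨h1, C, fun N n hn => (hC N n hn).trans ?_⟩
  exact mul_le_mul_of_nonneg_left (Real.rpow_le_rpow_of_exponent_le
    (by linarith [Nat.cast_nonneg (α := ℝ) n]) hrs) (nonneg_const hC)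

theorem const (c : ℂ) : DominatedLimit 0 (fun _ _ => c) (fun _ => c) :=
  ⟨fun _ => tendsto_const_nhds, ‖c‖, fun N n _ => by simp⟩

theorem sum {ι : Type*} (S : Finset ι) {κ : ι → ℕ → ℕ → ℂ} {κ' : ι → ℕ → ℂ} (hr : 0 ≤ r)
    (h : ∀ i ∈ S, DominatedLimit r (κ i) (κ' i)) :
    DominatedLimit r (fun N n => ∑ i ∈ S, κ i N n) (fun n => ∑ i ∈ S, κ' i n) := by
  classical
  induction S using Finset.induction_on with
  | empty => simpa using (const 0).mono hr
  | insert i S hi ih =>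
    simp only [Finset.sum_insert hi]
    exact (h i (Finset.mem_insert_self i S)).add
      (ih fun j hj => h j (Finset.mem_insert_of_mem hj))

end DominatedLimit

/-- The exponent `1/4` is chosen so that a product of two such factors grows at most like `√(n+1)`,
which remains summable against `1/(n+1)^2`. -/
theorem harmonic_le_rpow (n : ℕ) : (harmonic n : ℝ) ≤ 5 * ((n : ℝ) + 1) ^ (1 / 4 : ℝ) := by
  have h1 := harmonic_le_one_add_log n
  have hn : (0 : ℝ) ≤ n := Nat.cast_nonneg n
  have h2 := Real.log_le_rpow_div hn (show (0 : ℝ) < 1 / 4 by norm_num)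
  have h3 : (n : ℝ) ^ (1 / 4 : ℝ) ≤ ((n : ℝ) + 1) ^ (1 / 4 : ℝ) :=
    Real.rpow_le_rpow hn (by linarith) (by norm_num)
  have h4 : 1 ≤ ((n : ℝ) + 1) ^ (1 / 4 : ℝ) := Real.one_le_rpow (by linarith) (by norm_num)
  have h5 : (n : ℝ) ^ (1 / 4 : ℝ) / (1 / 4) = 4 * (n : ℝ) ^ (1 / 4 : ℝ) := by ring
  linarith

/-- A block of `b` consecutive terms is largest when it starts at the beginning, with exponent `1`.
The bound is independent of `a`, hence of the cutoff `N` in the applications. -/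
theorem norm_genHarmonic_add_sub_le {q : ℕ} (hq : 1 ≤ q) (a b : ℕ) :
    ‖genHarmonic q (a + b) - genHarmonic q a‖ ≤ harmonic b := by
  rw [genHarmonic_add, add_sub_cancel_left, harmonic]
  push_cast
  refine (norm_sum_le _ _).trans (Finset.sum_le_sum fun k _ => ?_)
  have : ((a : ℂ) + k + 1) = ((a + k + 1 : ℝ) : ℂ) := by push_cast; ring
  rw [norm_div, norm_one, norm_pow, this, Complex.norm_real, Real.norm_of_nonneg (by positivity),
    one_div]
  have ha : (0 : ℝ) ≤ a := Nat.cast_nonneg a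
  have hk : (0 : ℝ) ≤ k := Nat.cast_nonneg k
  refine inv_anti₀ (by positivity) ?_
  calc (k : ℝ) + 1 ≤ a + k + 1 := by linarith
    _ = (a + k + 1 : ℝ) ^ 1 := (pow_one _).symm
    _ ≤ _ := pow_le_pow_right₀ (by linarith) hq

theorem norm_genHarmonic_le {q : ℕ} (hq : 1 ≤ q) (n : ℕ) : ‖genHarmonic q n‖ ≤ harmonic n := by
  have h := norm_genHarmonic_add_sub_le hq 0 n
  simpa [genHarmonic] using h

theorem exists_norm_genHarmonic_le {q : ℕ} (hq : 2 ≤ q) : ∃ C : ℝ, ∀ n, ‖genHarmonic q n‖ ≤ C := by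
  obtain ⟨C, hC⟩ := (Metric.isBounded_range_of_tendsto _ (tendsto_genHarmonic hq)).exists_norm_le
  exact ⟨C, fun n => hC _ ⟨n, rfl⟩⟩

theorem dominatedLimit_genHarmonic {q : ℕ} (hq : 1 ≤ q) :
    DominatedLimit (1 / 4) (fun _ n => genHarmonic q n) (genHarmonic q) :=
  ⟨fun _ => tendsto_const_nhds, 5, fun _ n _ => (norm_genHarmonic_le hq n).trans (harmonic_le_rpow n)⟩

theorem rpow_quarter_mul_le {c x y : ℝ} (hc : 1 ≤ c) (hx : 0 ≤ x) (hy : 0 ≤ y) (h : x ≤ c * y) :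
    x ^ (1 / 4 : ℝ) ≤ c * y ^ (1 / 4 : ℝ) := by
  calc x ^ (1 / 4 : ℝ) ≤ (c * y) ^ (1 / 4 : ℝ) := Real.rpow_le_rpow hx h (by norm_num)
    _ = c ^ (1 / 4 : ℝ) * y ^ (1 / 4 : ℝ) := Real.mul_rpow (by linarith) hy
    _ ≤ c ^ (1 : ℝ) * y ^ (1 / 4 : ℝ) := by gcongr; norm_num
    _ = _ := by rw [Real.rpow_one]

theorem le_const_mul_rpow {C : ℝ} (hC : 0 ≤ C) (n : ℕ) : C ≤ C * ((n : ℝ) + 1) ^ (1 / 4 : ℝ) :=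
  le_mul_of_one_le_right hC
    (Real.one_le_rpow (by linarith [Nat.cast_nonneg (α := ℝ) n]) (by norm_num))

/-- For `q = 1` the divergent parts combine into `H_{N+1} - H_{N-n}`, a block of `n + 1` terms,
bounded by `H_{n+1}` for every `N ≥ n`. For `q ≥ 2` all harmonic numbers are bounded. -/
theorem dominatedLimit_truncZeta {q : ℕ} (hq : 1 ≤ q) :
    DominatedLimit (1 / 4) (truncZeta q) (fun n => zetaNat q + (-1) ^ q * genHarmonic q n) := by
  refine ⟨tendsto_truncZeta hq, ?_⟩
  unfold truncZeta
  by_cases h : q = 1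
  · subst h
    refine ⟨15, fun N n hn => ?_⟩
    simp only [if_true]
    have h1 := norm_genHarmonic_add_sub_le hq (N - n) (n + 1)
    rw [show N - n + (n + 1) = N + 1 by omega] at h1
    have h2 := norm_genHarmonic_le hq n
    have h3 := harmonic_le_rpow n
    have h4 := harmonic_le_rpow (n + 1)
    have h5 : (((n + 1 : ℕ) : ℝ) + 1) ^ (1 / 4 : ℝ) ≤ 2 * ((n : ℝ) + 1) ^ (1 / 4 : ℝ) := by
      refine rpow_quarter_mul_le (by norm_num) (by positivity) (by positivity) ?_
      push_cast
      linarith [Nat.cast_nonneg (α := ℝ) n]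
    have e : genHarmonic 1 (N - n) + (-1) ^ 1 * genHarmonic 1 n - genHarmonic 1 (N + 1)
        = -(genHarmonic 1 (N + 1) - genHarmonic 1 (N - n)) - genHarmonic 1 n := by ring
    rw [e]
    refine (norm_sub_le _ _).trans ?_
    rw [norm_neg]
    linarith
  · obtain ⟨C, hC⟩ := exists_norm_genHarmonic_le (q := q) (by omega)
    refine ⟨C + C, fun N n _ => ?_⟩
    simp only [if_neg h, sub_zero]
    have hC0 : 0 ≤ C := (norm_nonneg _).trans (hC 0)
    refine le_trans ?_ (le_const_mul_rpow (add_nonneg hC0 hC0) n)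
    refine (norm_add_le _ _).trans (add_le_add (hC _) ?_)
    simpa using hC n

theorem dominatedLimit_truncHurwitz_natCast {q : ℕ} (hq : 1 ≤ q) :
    DominatedLimit (1 / 4) (fun N n => truncHurwitz q N ((n + 1 : ℕ) : ℂ))
      (fun n => zetaNat q - genHarmonic q n) := by
  refine ⟨tendsto_truncHurwitz_natCast hq, ?_⟩
  simp only [truncHurwitz_natCast_add_one]
  by_cases h : q = 1
  · subst h
    refine ⟨10, fun N n hn => ?_⟩
    simp only [if_true]
    have h1 := norm_genHarmonic_add_sub_le hq (N + 1) n
    have h2 := norm_genHarmonic_le hq n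
    have h3 := harmonic_le_rpow n
    have e : genHarmonic 1 (n + (N + 1)) - genHarmonic 1 n - genHarmonic 1 (N + 1)
        = (genHarmonic 1 (N + 1 + n) - genHarmonic 1 (N + 1)) - genHarmonic 1 n := by
      rw [add_comm n]; ring
    rw [e]
    refine (norm_sub_le _ _).trans ?_
    linarith
  · obtain ⟨C, hC⟩ := exists_norm_genHarmonic_le (q := q) (by omega)
    refine ⟨C + C, fun N n _ => ?_⟩
    simp only [if_neg h, sub_zero]
    have hC0 : 0 ≤ C := (norm_nonneg _).trans (hC 0)
    refine le_trans ?_ (le_const_mul_rpow (add_nonneg hC0 hC0) n)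
    exact (norm_sub_le _ _).trans (add_le_add (hC _) (hC _))

theorem dominatedLimit_cotCoeff (k : ℕ) :
    DominatedLimit (1 / 4) (fun N n => cotCoeff N n k) (fun _ => cotCoeffLim k) := by
  refine ⟨fun n => tendsto_cotCoeff n k, ?_⟩
  rcases k with _ | _ | k
  · exact ⟨1, fun N n _ => by simpa [cotCoeff] using le_const_mul_rpow zero_le_one n⟩
  · refine ⟨10, fun N n hn => ?_⟩
    have h1 := norm_genHarmonic_add_sub_le le_rfl (N - n) (2 * n)
    rw [show N - n + 2 * n = N + n by omega] at h1
    have h4 := harmonic_le_rpow (2 * n)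
    have h5 : (((2 * n : ℕ) : ℝ) + 1) ^ (1 / 4 : ℝ) ≤ 2 * ((n : ℝ) + 1) ^ (1 / 4 : ℝ) := by
      refine rpow_quarter_mul_le (by norm_num) (by positivity) (by positivity) ?_
      push_cast
      linarith [Nat.cast_nonneg (α := ℝ) n]
    have e : cotCoeff N n (0 + 1) = -(genHarmonic 1 (N + n) - genHarmonic 1 (N - n)) := by
      simp only [cotCoeff]; ring
    change ‖cotCoeff N n (0 + 1)‖ ≤ _
    rw [e, norm_neg]
    linarith
  · obtain ⟨C, hC⟩ := exists_norm_genHarmonic_le (q := k + 1 + 1) (by omega)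
    refine ⟨C + C, fun N n _ => ?_⟩
    have hC0 : 0 ≤ C := (norm_nonneg _).trans (hC 0)
    refine le_trans ?_ (le_const_mul_rpow (add_nonneg hC0 hC0) n)
    simp only [cotCoeff, norm_mul, norm_pow, norm_neg, norm_one, one_pow, one_mul]
    refine (norm_add_le _ _).trans (add_le_add (hC _) ?_)
    simpa using hC (N + n)

theorem dominatedLimit_hurwitzCoeff {q : ℕ} (hq : 1 ≤ q) (k : ℕ) :
    DominatedLimit (1 / 4) (fun N n => hurwitzCoeff q N n k)
      (fun n => (-1) ^ k * ((k + q - 1).choose (q - 1) : ℂ) *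
        (zetaNat (k + q) + (-1) ^ (k + q) * genHarmonic (k + q) n)) :=
  (dominatedLimit_truncZeta (show 1 ≤ k + q by omega)).const_mul _

theorem isBigO_one_div_natCast_add (a : ℂ) :
    (fun n : ℕ => 1 / ((n : ℂ) + a)) =O[atTop] fun n : ℕ => 1 / ((n : ℝ) + 1) := by
  refine Asymptotics.IsBigO.of_bound 3 ?_
  obtain ⟨N, hN⟩ := exists_nat_gt (2 * ‖a‖)
  filter_upwards [eventually_ge_atTop (N + 1)] with n hn
  have hn' : (N : ℝ) + 1 ≤ n := by exact_mod_cast hn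
  have hlow : ((n : ℝ) + 1) / 3 ≤ ‖(n : ℂ) + a‖ := by
    have := norm_sub_le_norm_add (n : ℂ) a
    rw [Complex.norm_natCast] at this
    linarith [norm_nonneg a]
  rw [norm_div, norm_one, Real.norm_of_nonneg (by positivity)]
  calc 1 / ‖(n : ℂ) + a‖ ≤ 1 / (((n : ℝ) + 1) / 3) := by gcongr
    _ = _ := by field_simp

theorem isBigO_one_div_pow_sub (a b : ℂ) (e : ℕ) :
    (fun n : ℕ => 1 / ((n : ℂ) + a) ^ e - 1 / ((n : ℂ) + b) ^ e) =O[atTop]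
      fun n : ℕ => 1 / ((n : ℝ) + 1) ^ 2 := by
  have hx := isBigO_one_div_natCast_add a
  have hy := isBigO_one_div_natCast_add b
  have hone : (fun n : ℕ => 1 / ((n : ℝ) + 1)) =O[atTop] fun _ : ℕ => (1 : ℝ) := by
    refine Asymptotics.IsBigO.of_bound 1 (Eventually.of_forall fun n => ?_)
    have hn : (0 : ℝ) ≤ n := Nat.cast_nonneg n
    rw [Real.norm_of_nonneg (by positivity), norm_one, mul_one, div_le_one (by positivity)]
    linarith
  have hxy : (fun n : ℕ => 1 / ((n : ℂ) + a) - 1 / ((n : ℂ) + b)) =O[atTop]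
      fun n : ℕ => 1 / ((n : ℝ) + 1) ^ 2 := by
    have h1 := ((hx.mul hy).const_mul_left (b - a))
    refine (h1.congr' ?_ ?_)
    · obtain ⟨A, hA⟩ := exists_nat_gt ‖a‖
      obtain ⟨B, hB⟩ := exists_nat_gt ‖b‖
      filter_upwards [eventually_ge_atTop A, eventually_ge_atTop B] with n hnA hnB
      have ha : (n : ℂ) + a ≠ 0 := by
        intro h
        have h2 : ‖a‖ = n := by rw [eq_neg_of_add_eq_zero_right h]; simp
        have : (A : ℝ) ≤ n := by exact_mod_cast hnA
        linarith
      have hb : (n : ℂ) + b ≠ 0 := by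
        intro h
        have h2 : ‖b‖ = n := by rw [eq_neg_of_add_eq_zero_right h]; simp
        have : (B : ℝ) ≤ n := by exact_mod_cast hnB
        linarith
      field_simp
      ring
    · refine Eventually.of_forall fun n => ?_
      simp only [sq, one_div, mul_inv]
  induction e with
  | zero => simpa using Asymptotics.isBigO_zero _ _
  | succ e ih =>
    -- With `x`, `y` the two reciprocals, `x^(e+1) - y^(e+1) = x (x^e - y^e) + y^e (x - y)`.
    have h1 := (hx.trans hone).mul ih
    have h2 := ((hy.trans hone).pow e).mul hxy
    simp only [one_mul, one_pow] at h1 h2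
    refine (h1.add h2).congr_left fun n => ?_
    simp only [one_div, pow_succ, inv_pow, mul_inv]
    ring

theorem exists_norm_one_div_pow_sub_le (a b : ℂ) (e : ℕ) : ∃ C : ℝ, 0 < C ∧ ∀ n : ℕ,
    ‖1 / ((n : ℂ) + a) ^ e - 1 / ((n : ℂ) + b) ^ e‖ ≤ C * (1 / ((n : ℝ) + 1) ^ 2) := by
  obtain ⟨C, hC, h⟩ := Asymptotics.bound_of_isBigO_nat_atTop (isBigO_one_div_pow_sub a b e)
  refine ⟨C, hC, fun n => ?_⟩
  have := @h n (by positivity)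
  rwa [Real.norm_of_nonneg (by positivity)] at this

theorem summable_rpow_half_mul :
    Summable fun n : ℕ => ((n : ℝ) + 1) ^ (1 / 2 : ℝ) * (1 / ((n : ℝ) + 1) ^ 2) := by
  have h := (summable_nat_add_iff 1).mpr (Real.summable_nat_rpow.mpr (show (-(3 / 2) : ℝ) < -1 by norm_num))
  refine h.congr fun n => ?_
  have hn : (0 : ℝ) < (n : ℝ) + 1 := by positivity
  rw [one_div (_ ^ 2), ← Real.rpow_natCast, ← Real.rpow_neg hn.le, ← Real.rpow_add hn]
  push_cast
  norm_num

namespace DominatedLimit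

variable {κ : ℕ → ℕ → ℂ} {κ' : ℕ → ℂ}

theorem exists_bound (h : DominatedLimit (1 / 2) κ κ') (a b : ℂ) (e : ℕ) :
    ∃ D : ℝ, 0 ≤ D ∧ ∀ N n, n ≤ N → ‖κ N n * (1 / ((n : ℂ) + a) ^ e - 1 / ((n : ℂ) + b) ^ e)‖ ≤
      D * (((n : ℝ) + 1) ^ (1 / 2 : ℝ) * (1 / ((n : ℝ) + 1) ^ 2)) := by
  obtain ⟨-, C, hC⟩ := h
  obtain ⟨D, hD0, hD⟩ := exists_norm_one_div_pow_sub_le a b e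
  have hC0 := nonneg_const hC
  refine ⟨C * D, mul_nonneg hC0 hD0.le, fun N n hn => ?_⟩
  rw [norm_mul]
  calc _ ≤ (C * ((n : ℝ) + 1) ^ (1 / 2 : ℝ)) * (D * (1 / ((n : ℝ) + 1) ^ 2)) :=
        mul_le_mul (hC N n hn) (hD n) (norm_nonneg _) (mul_nonneg hC0 (by positivity))
    _ = _ := by ring

theorem summable (h : DominatedLimit (1 / 2) κ κ') (a b : ℂ) (e : ℕ) :
    Summable fun n : ℕ => κ' n * (1 / ((n : ℂ) + a) ^ e - 1 / ((n : ℂ) + b) ^ e) := by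
  obtain ⟨D, _, hD⟩ := h.exists_bound a b e
  refine (summable_rpow_half_mul.mul_left D).of_norm_bounded fun n => ?_
  refine le_of_tendsto ((h.1 n).mul_const _).norm ?_
  filter_upwards [eventually_ge_atTop n] with N hN
  exact hD N n hN

theorem tendsto_sum (h : DominatedLimit (1 / 2) κ κ') (a b : ℂ) (e : ℕ) {u : ℕ → ℕ}
    (hu : Tendsto u atTop atTop) (hu' : ∀ N, u N ≤ N + 1) :
    Tendsto (fun N => ∑ n ∈ Finset.range (u N),
        κ N n * (1 / ((n : ℂ) + a) ^ e - 1 / ((n : ℂ) + b) ^ e)) atTop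
      (𝓝 (∑' n : ℕ, κ' n * (1 / ((n : ℂ) + a) ^ e - 1 / ((n : ℂ) + b) ^ e))) := by
  obtain ⟨D, hD0, hD⟩ := h.exists_bound a b e
  -- The finite sums are extended by zero. Since `u N ≤ N + 1`, every index that occurs satisfies `n
  -- ≤ N`, the range where the uniform bound holds.
  have key := tendsto_tsum_of_dominated_convergence (𝓕 := atTop)
    (f := fun N n => if n < u N then κ N n * (1 / ((n : ℂ) + a) ^ e - 1 / ((n : ℂ) + b) ^ e) else 0)
    (g := fun n => κ' n * (1 / ((n : ℂ) + a) ^ e - 1 / ((n : ℂ) + b) ^ e))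
    (summable_rpow_half_mul.mul_left D) ?_ ?_
  · refine key.congr fun N => ?_
    rw [tsum_eq_sum (s := Finset.range (u N))]
    · exact Finset.sum_congr rfl fun n hn => if_pos (Finset.mem_range.mp hn)
    · intro n hn
      rw [Finset.mem_range] at hn
      exact if_neg hn
  · intro n
    refine ((h.1 n).mul_const _).congr' ?_
    filter_upwards [hu.eventually_gt_atTop n] with N hN
    rw [if_pos hN]
  · refine Eventually.of_forall fun N n => ?_
    split_ifs with hn
    · exact hD N n (by have := hu' N; omega)
    · rw [norm_zero]; positivity

end DominatedLimit

end Dominated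

/-! ### The limiting expansion and its identification with the stated sums. -/

section DiffSeries

open Filter Topology Finset.HasAntidiagonal

/-- The series `∑ h n (1 / (n + a) ^ e - 1 / (n + b) ^ e)`. -/
noncomputable def diffSeries (a b : ℂ) (e : ℕ) (h : ℕ → ℂ) : ℂ :=
  ∑' n : ℕ, h n * (1 / ((n : ℂ) + a) ^ e - 1 / ((n : ℂ) + b) ^ e)

/-- Sequences of growth at most `√n`. -/
def HalfGrowth (h : ℕ → ℂ) : Prop := DominatedLimit (1 / 2) (fun _ n => h n) h

theorem HalfGrowth.hasSum {h : ℕ → ℂ} (hh : HalfGrowth h) (a b : ℂ) (e : ℕ) :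
    HasSum (fun n : ℕ => h n * (1 / ((n : ℂ) + a) ^ e - 1 / ((n : ℂ) + b) ^ e))
      (diffSeries a b e h) :=
  (hh.summable a b e).hasSum

theorem halfGrowth_one : HalfGrowth (fun _ => 1) :=
  (DominatedLimit.const 1).mono (by norm_num)

theorem halfGrowth_genHarmonic {q : ℕ} (hq : 1 ≤ q) : HalfGrowth (genHarmonic q) :=
  (dominatedLimit_genHarmonic hq).mono (by norm_num)

theorem halfGrowth_genHarmonic_mul {p m : ℕ} (hp : 1 ≤ p) (hm : 1 ≤ m) :
    HalfGrowth (fun n => genHarmonic p n * genHarmonic m n) :=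
  ((dominatedLimit_genHarmonic hp).mul (dominatedLimit_genHarmonic hm)).mono (by norm_num)

theorem diffSeries_one {a b : ℂ} (ha : ∀ n : ℤ, a ≠ n) (hb : ∀ n : ℤ, b ≠ n) {e : ℕ} (he : 1 ≤ e) :
    diffSeries a b e (fun _ => 1) = hurwitzNat e a - hurwitzNat e b := by
  have h1 := (tendsto_truncHurwitz e he ha).sub (tendsto_truncHurwitz e he hb)
  have h2 := (halfGrowth_one.hasSum a b e).tendsto_sum_nat.comp (tendsto_add_atTop_nat 1)
  refine tendsto_nhds_unique (h2.congr fun N => ?_) h1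
  simp only [Function.comp, truncHurwitz, one_mul, Finset.sum_sub_distrib]
  ring

theorem sum_Icc_one_eq_range (N : ℕ) (f : ℕ → ℂ) :
    ∑ j ∈ Finset.Icc 1 N, f j = ∑ n ∈ Finset.range N, f (n + 1) := by
  rw [← Finset.Ico_add_one_right_eq_Icc, Finset.sum_Ico_eq_sum_range, Nat.add_sub_cancel]
  exact Finset.sum_congr rfl fun n _ => by rw [add_comm]

theorem one_div_sub_natCast_succ (a b : ℂ) (n : ℕ) :
    1 / (a - ((n + 1 : ℕ) : ℂ)) - 1 / (b - ((n + 1 : ℕ) : ℂ))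
      = -(1 / ((n : ℂ) + (1 - a)) ^ 1 - 1 / ((n : ℂ) + (1 - b)) ^ 1) := by
  have e : ∀ c : ℂ, c - ((n + 1 : ℕ) : ℂ) = -((n : ℂ) + (1 - c)) := fun c => by push_cast; ring
  rw [e a, e b, pow_one, pow_one, one_div_neg_eq_neg_one_div, one_div_neg_eq_neg_one_div]
  ring

/-- The expansion of the cotangent alone. It converts the constant parts `ζ(p)ζ(m)` of the residues
at both families of poles into cotangent terms. -/
theorem cot_sub_cot {a b : ℂ} (ha : ∀ n : ℤ, a ≠ n) (hb : ∀ n : ℤ, b ≠ n) :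
    Real.pi * Complex.cot (Real.pi * a) - Real.pi * Complex.cot (Real.pi * b)
      = diffSeries a b 1 (fun _ => 1) - diffSeries (1 - a) (1 - b) 1 (fun _ => 1) := by
  have h1 := (tendsto_truncCot ha).sub (tendsto_truncCot hb)
  have h2 := (halfGrowth_one.hasSum a b 1).tendsto_sum_nat.comp (tendsto_add_atTop_nat 1)
  have h3 := (halfGrowth_one.hasSum (1 - a) (1 - b) 1).tendsto_sum_nat
  refine tendsto_nhds_unique h1 ((h2.sub h3).congr fun N => ?_)
  have e : ∑ j ∈ Finset.Icc 1 N, (1 / (a - j) - 1 / (b - j)) = -∑ n ∈ Finset.range N,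
      (1 / ((n : ℂ) + (1 - a)) ^ 1 - 1 / ((n : ℂ) + (1 - b)) ^ 1) := by
    rw [sum_Icc_one_eq_range, ← Finset.sum_neg_distrib]
    exact Finset.sum_congr rfl fun n _ => one_div_sub_natCast_succ a b n
  rw [Finset.sum_sub_distrib] at e
  simp only [Function.comp, truncCot, one_mul]
  rw [Finset.sum_sub_distrib]
  simp only [pow_one] at e ⊢
  linear_combination -e

/-- The limit of the Taylor coefficients `hurwitzCoeff`. -/
noncomputable def hurwitzCoeffLim (q k n : ℕ) : ℂ :=
  (-1) ^ k * ((k + q - 1).choose (q - 1) : ℂ) *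
    (zetaNat (k + q) + (-1) ^ (k + q) * genHarmonic (k + q) n)

theorem principalPart_sub (p m : ℕ) (α β γ : ℕ → ℂ) (x y : ℂ) :
    principalPart p m α β γ x - principalPart p m α β γ y =
      ∑ k ∈ Finset.range (p + m + 1), α k * (1 / x ^ (p + m + 1 - k) - 1 / y ^ (p + m + 1 - k))
      + ∑ k ∈ Finset.range (m + 1), (∑ ij ∈ antidiagonal k, α ij.1 * β ij.2) *
          (1 / x ^ (m + 1 - k) - 1 / y ^ (m + 1 - k))
      + ∑ k ∈ Finset.range (p + 1), (∑ ij ∈ antidiagonal k, α ij.1 * γ ij.2) *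
          (1 / x ^ (p + 1 - k) - 1 / y ^ (p + 1 - k))
      + β 0 * γ 0 * (1 / x ^ 1 - 1 / y ^ 1) := by
  simp only [principalPart, mul_sub, mul_one_div, Finset.sum_sub_distrib, pow_one]
  ring

theorem dominatedLimit_cotCoeff_mul_hurwitzCoeff {q : ℕ} (hq : 1 ≤ q) (k : ℕ) :
    DominatedLimit (1 / 2)
      (fun N n => ∑ ij ∈ antidiagonal k, cotCoeff N n ij.1 * hurwitzCoeff q N n ij.2)
      (fun n => ∑ ij ∈ antidiagonal k, cotCoeffLim ij.1 * hurwitzCoeffLim q ij.2 n) :=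
  DominatedLimit.sum _ (by norm_num) fun ij _ =>
    ((dominatedLimit_cotCoeff ij.1).mul (dominatedLimit_hurwitzCoeff hq ij.2)).mono (by norm_num)

/-- The limit of the partial fraction expansions. -/
theorem cot_mul_hurwitzNat_sub {p m : ℕ} (hp : 1 ≤ p) (hm : 1 ≤ m) {a b : ℂ}
    (ha : ∀ n : ℤ, a ≠ n) (hb : ∀ n : ℤ, b ≠ n) :
    Real.pi * Complex.cot (Real.pi * a) * hurwitzNat p a * hurwitzNat m a
        - Real.pi * Complex.cot (Real.pi * b) * hurwitzNat p b * hurwitzNat m b =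
      ∑ k ∈ Finset.range (p + m + 1), diffSeries a b (p + m + 1 - k) (fun _ => cotCoeffLim k)
      + ∑ k ∈ Finset.range (m + 1), diffSeries a b (m + 1 - k)
          (fun n => ∑ ij ∈ antidiagonal k, cotCoeffLim ij.1 * hurwitzCoeffLim p ij.2 n)
      + ∑ k ∈ Finset.range (p + 1), diffSeries a b (p + 1 - k)
          (fun n => ∑ ij ∈ antidiagonal k, cotCoeffLim ij.1 * hurwitzCoeffLim m ij.2 n)
      + diffSeries a b 1 (fun n => hurwitzCoeffLim p 0 n * hurwitzCoeffLim m 0 n)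
      - diffSeries (1 - a) (1 - b) 1
          (fun n => (zetaNat p - genHarmonic p n) * (zetaNat m - genHarmonic m n)) := by
  -- The difference of the values at `a` and `b` is essential: with exponent `1` the separate series
  -- need not converge.
  have hlim := (((tendsto_truncCot ha).mul (tendsto_truncHurwitz p hp ha)).mul
    (tendsto_truncHurwitz m hm ha)).sub (((tendsto_truncCot hb).mul
    (tendsto_truncHurwitz p hp hb)).mul (tendsto_truncHurwitz m hm hb))
  have hu : Tendsto (fun N : ℕ => N + 1) atTop atTop := tendsto_add_atTop_nat 1
  have hu' : ∀ N : ℕ, N + 1 ≤ N + 1 := fun _ => le_rfl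
  have h1 := tendsto_finsetSum (Finset.range (p + m + 1)) fun k _ =>
    ((dominatedLimit_cotCoeff k).mono (show (1 / 4 : ℝ) ≤ 1 / 2 by norm_num)).tendsto_sum a b
      (p + m + 1 - k) hu hu'
  have h2 := tendsto_finsetSum (Finset.range (m + 1)) fun k _ =>
    (dominatedLimit_cotCoeff_mul_hurwitzCoeff hp k).tendsto_sum a b (m + 1 - k) hu hu'
  have h3 := tendsto_finsetSum (Finset.range (p + 1)) fun k _ =>
    (dominatedLimit_cotCoeff_mul_hurwitzCoeff hm k).tendsto_sum a b (p + 1 - k) hu hu'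
  have h4 := (((dominatedLimit_hurwitzCoeff hp 0).mul (dominatedLimit_hurwitzCoeff hm 0)).mono
    (show (1 / 4 + 1 / 4 : ℝ) ≤ 1 / 2 by norm_num)).tendsto_sum a b 1 hu hu'
  -- The poles `j = 1, …, N` are indexed by `n = j - 1`, so there are `N` terms here against `N + 1`
  -- in the other sums, and `a - j` becomes `-(n + (1 - a))`.
  have h5 := (((dominatedLimit_truncHurwitz_natCast hp).mul
    (dominatedLimit_truncHurwitz_natCast hm)).mono
    (show (1 / 4 + 1 / 4 : ℝ) ≤ 1 / 2 by norm_num)).tendsto_sum (1 - a) (1 - b) 1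
      (u := fun N => N) tendsto_id fun N => by omega
  refine tendsto_nhds_unique hlim (((((h1.add h2).add h3).add h4).sub h5).congr fun N => ?_)
  rw [truncCot_mul_truncHurwitz_mul hp hm N ha, truncCot_mul_truncHurwitz_mul hp hm N hb]
  have e1 : ∑ n ∈ Finset.range (N + 1), (principalPart p m (cotCoeff N n) (hurwitzCoeff p N n)
        (hurwitzCoeff m N n) (a + n) - principalPart p m (cotCoeff N n) (hurwitzCoeff p N n)
        (hurwitzCoeff m N n) (b + n)) = _ :=
    Finset.sum_congr rfl fun n _ => principalPart_sub _ _ _ _ _ _ _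
  have e2 : ∑ j ∈ Finset.Icc 1 N, (truncHurwitz p N j * truncHurwitz m N j / (a - j)
      - truncHurwitz p N j * truncHurwitz m N j / (b - j))
      = -∑ n ∈ Finset.range N, truncHurwitz p N ((n + 1 : ℕ) : ℂ) * truncHurwitz m N ((n + 1 : ℕ) : ℂ)
        * (1 / ((n : ℂ) + (1 - a)) ^ 1 - 1 / ((n : ℂ) + (1 - b)) ^ 1) := by
    rw [sum_Icc_one_eq_range, ← Finset.sum_neg_distrib]
    refine Finset.sum_congr rfl fun n _ => ?_
    have := one_div_sub_natCast_succ a b n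
    rw [← mul_one_div _ (a - _), ← mul_one_div _ (b - _), ← mul_sub, this]
    ring
  rw [Finset.sum_sub_distrib] at e1
  simp only [Finset.sum_add_distrib] at e1
  rw [Finset.sum_sub_distrib] at e2
  rw [Finset.sum_comm (s := Finset.range (N + 1)), Finset.sum_comm (s := Finset.range (N + 1)),
    Finset.sum_comm (s := Finset.range (N + 1))] at e1
  simp only [add_comm a, add_comm b] at e1 ⊢
  linear_combination -e1 - e2

theorem sum_cotCoeffLim_mul (M : ℕ) (F : ℕ → ℂ) :
    ∑ k ∈ Finset.range (M + 1), cotCoeffLim k * F k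
      = -2 * ∑ k ∈ Finset.range (M / 2 + 1), zetaNat (2 * k) * F (2 * k) := by
  rw [Finset.mul_sum]
  symm
  refine Finset.sum_of_injOn (fun k => 2 * k) (fun x _ y _ h => by simpa using h) ?_ ?_ ?_
  · intro k hk
    simp only [Finset.coe_range, Set.mem_Iio] at hk ⊢
    omega
  · intro k hk hk'
    have : ¬ Even k := by
      rintro ⟨j, rfl⟩
      apply hk'
      rw [Finset.mem_range] at hk
      exact ⟨j, by simp only [Finset.coe_range, Set.mem_Iio]; omega, by simp only; omega⟩
    rw [cotCoeffLim, if_neg this, zero_mul]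
  · intro k _
    rw [cotCoeffLim, if_pos (even_two_mul k)]
    ring

theorem diffSeries_cotCoeffLim_mul_hurwitzCoeffLim {q : ℕ} (hq : 1 ≤ q) {a b : ℂ}
    (ha : ∀ n : ℤ, a ≠ n) (hb : ∀ n : ℤ, b ≠ n) (k : ℕ) {e : ℕ} (he : 1 ≤ e) :
    diffSeries a b e (fun n => ∑ ij ∈ antidiagonal k, cotCoeffLim ij.1 * hurwitzCoeffLim q ij.2 n)
      = ∑ ij ∈ antidiagonal k, cotCoeffLim ij.1 *
        ((-1) ^ ij.2 * ((ij.2 + q - 1).choose (q - 1) : ℂ) *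
          (zetaNat (ij.2 + q) * (hurwitzNat e a - hurwitzNat e b)
            + (-1) ^ (ij.2 + q) * diffSeries a b e (genHarmonic (ij.2 + q)))) := by
  have h : HasSum (fun n : ℕ => ∑ ij ∈ antidiagonal k, cotCoeffLim ij.1 *
        ((-1) ^ ij.2 * ((ij.2 + q - 1).choose (q - 1) : ℂ) *
          (zetaNat (ij.2 + q) * (1 * (1 / ((n : ℂ) + a) ^ e - 1 / ((n : ℂ) + b) ^ e))
            + (-1) ^ (ij.2 + q) * (genHarmonic (ij.2 + q) n *
              (1 / ((n : ℂ) + a) ^ e - 1 / ((n : ℂ) + b) ^ e)))))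
      (∑ ij ∈ antidiagonal k, cotCoeffLim ij.1 *
        ((-1) ^ ij.2 * ((ij.2 + q - 1).choose (q - 1) : ℂ) *
          (zetaNat (ij.2 + q) * (hurwitzNat e a - hurwitzNat e b)
            + (-1) ^ (ij.2 + q) * diffSeries a b e (genHarmonic (ij.2 + q))))) := by
    refine hasSum_sum fun ij _ => HasSum.mul_left _ (HasSum.mul_left _ (HasSum.add
      (HasSum.mul_left _ ?_) (HasSum.mul_left _ ?_)))
    · rw [← diffSeries_one ha hb he]
      exact halfGrowth_one.hasSum a b e
    · exact (halfGrowth_genHarmonic (by omega)).hasSum a b e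
  rw [← h.tsum_eq, diffSeries]
  refine tsum_congr fun n => ?_
  rw [Finset.sum_mul]
  refine Finset.sum_congr rfl fun ij _ => ?_
  rw [hurwitzCoeffLim]
  ring

/-- Odd cotangent coefficients vanish, so the Cauchy product only involves `i = 2 k₁`, and `j = k₂ -
1`. The factor `-2` in the even coefficients together with `(-1)^j = -(-1)^(k₂)` gives the factor
`2`. -/
theorem sum_diffSeries_eq_crossSum {p : ℕ} (m : ℕ) (hp : 1 ≤ p) {a b : ℂ}
    (ha : ∀ n : ℤ, a ≠ n) (hb : ∀ n : ℤ, b ≠ n) :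
    ∑ k ∈ Finset.range (m + 1), diffSeries a b (m + 1 - k)
        (fun n => ∑ ij ∈ antidiagonal k, cotCoeffLim ij.1 * hurwitzCoeffLim p ij.2 n)
      = 2 * crossSum p m a b := by
  rw [Finset.sum_congr rfl fun k hk => diffSeries_cotCoeffLim_mul_hurwitzCoeffLim hp ha hb k
    (show 1 ≤ m + 1 - k by rw [Finset.mem_range] at hk; omega), Finset.sum_sigma', crossSum,
    Finset.mul_sum]
  symm
  -- A pair `(k₁, k₂)` goes to the antidiagonal point `(2 k₁, k₂ - 1)`; what the map misses has odd
  -- first entry and contributes `0`.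
  refine Finset.sum_of_injOn (fun k => ⟨2 * k.1 + (k.2 - 1), (2 * k.1, k.2 - 1)⟩) ?_ ?_ ?_ ?_
  · rintro ⟨x, y⟩ hx ⟨x', y'⟩ hx' h
    rw [Finset.mem_coe, mem_indexPairs] at hx hx'
    simp only [Sigma.mk.injEq, heq_eq_eq, Prod.mk.injEq] at h hx hx' ⊢
    omega
  · rintro ⟨x, y⟩ hx
    rw [Finset.mem_coe, mem_indexPairs] at hx
    simp only at hx
    exact Finset.mem_sigma.mpr ⟨Finset.mem_range.mpr (show 2 * x + (y - 1) < m + 1 by omega),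
      Finset.HasAntidiagonal.mem_antidiagonal.mpr rfl⟩
  · rintro ⟨k, i, j⟩ hk hk'
    simp only [Finset.mem_sigma, Finset.mem_range, Finset.HasAntidiagonal.mem_antidiagonal] at hk
    have : ¬ Even i := by
      rintro ⟨l, rfl⟩
      apply hk'
      refine ⟨(l, j + 1), ?_, ?_⟩
      · rw [Finset.mem_coe, mem_indexPairs]
        simp only
        omega
      · obtain ⟨hk, rfl⟩ := hk
        simp only [Nat.add_sub_cancel, two_mul]
    simp only [cotCoeffLim, if_neg this, zero_mul]
  · rintro ⟨x, y⟩ hx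
    rw [mem_indexPairs] at hx
    obtain ⟨y, rfl⟩ := Nat.exists_eq_add_of_le' hx.1
    simp only at hx
    simp only [Nat.add_sub_cancel, cotCoeffLim, if_pos (even_two_mul x)]
    rw [show y + 1 + p - 2 = y + p - 1 by omega, show y + 1 + p - 1 = y + p by omega,
      show m + 2 - 2 * x - (y + 1) = m + 1 - (2 * x + y) by omega, diffSeries]
    simp only [mul_sub (genHarmonic _ _), mul_one_div]
    ring

/-- Partial fractions for a series over the positive integers. -/
theorem HalfGrowth.hasSum_pnat_add {h : ℕ → ℂ} (hh : HalfGrowth h) (h0 : h 0 = 0) {a b : ℂ}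
    (ha : ∀ n : ℤ, a ≠ n) (hb : ∀ n : ℤ, b ≠ n) (hab : a ≠ b) :
    HasSum (fun n : ℕ+ => h n / ((((n : ℕ) : ℂ) + a) * (((n : ℕ) : ℂ) + b)))
      (diffSeries a b 1 h / (b - a)) := by
  have h1 := (hh.hasSum a b 1).div_const (b - a)
  have hba : b - a ≠ 0 := sub_ne_zero.mpr hab.symm
  have hinj : Function.Injective (fun n : ℕ+ => (n : ℕ)) := PNat.coe_injective
  have h2 : (fun n : ℕ => h n * (1 / ((n : ℂ) + a) ^ 1 - 1 / ((n : ℂ) + b) ^ 1) / (b - a))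
      = fun n : ℕ => h n / (((n : ℂ) + a) * ((n : ℂ) + b)) := by
    funext n
    have e1 : (n : ℂ) + a ≠ 0 := fun h => ha (-n) (by push_cast; linear_combination h)
    have e2 : (n : ℂ) + b ≠ 0 := fun h => hb (-n) (by push_cast; linear_combination h)
    field_simp
    ring
  rw [h2, ← hinj.hasSum_iff] at h1
  · exact h1
  · intro n hn
    have : n = 0 := by
      by_contra hne
      exact hn ⟨⟨n, Nat.pos_of_ne_zero hne⟩, rfl⟩
    rw [this, h0, zero_div]

/-- After the shift `n ↦ n + 1` the denominators are `n + (1 - a)` and `n + (1 - b)`. Their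
difference is `a - b`, whence the minus sign. -/
theorem HalfGrowth.hasSum_pnat_sub {h : ℕ → ℂ} (hh : HalfGrowth h) {a b : ℂ}
    (ha : ∀ n : ℤ, a ≠ n) (hb : ∀ n : ℤ, b ≠ n) (hab : a ≠ b) :
    HasSum (fun n : ℕ+ => h ((n : ℕ) - 1) / ((((n : ℕ) : ℂ) - a) * (((n : ℕ) : ℂ) - b)))
      (-(diffSeries (1 - a) (1 - b) 1 h / (b - a))) := by
  have h1 := ((hh.hasSum (1 - a) (1 - b) 1).div_const (b - a)).neg
  have hba : b - a ≠ 0 := sub_ne_zero.mpr hab.symm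
  rw [← Equiv.pnatEquivNat.symm.hasSum_iff]
  have h2 : (fun n : ℕ => -(h n * (1 / ((n : ℂ) + (1 - a)) ^ 1 - 1 / ((n : ℂ) + (1 - b)) ^ 1) / (b - a)))
      = (fun n : ℕ+ => h ((n : ℕ) - 1) / ((((n : ℕ) : ℂ) - a) * (((n : ℕ) : ℂ) - b)))
        ∘ Equiv.pnatEquivNat.symm := by
    funext n
    have e1 : (n : ℂ) + 1 - a ≠ 0 := fun h => ha (n + 1) (by push_cast; linear_combination -h)
    have e2 : (n : ℂ) + 1 - b ≠ 0 := fun h => hb (n + 1) (by push_cast; linear_combination -h)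
    simp only [Function.comp, Equiv.pnatEquivNat_symm_apply, Nat.succPNat_coe, Nat.succ_eq_add_one,
      Nat.add_sub_cancel, pow_one]
    push_cast
    rw [← add_sub_assoc, ← add_sub_assoc]
    field_simp
    ring
  rwa [h2] at h1

theorem diffSeries_affine_mul {p m : ℕ} (hp : 1 ≤ p) (hm : 1 ≤ m) (a b x y z w : ℂ) (e : ℕ) :
    diffSeries a b e (fun n => (x + y * genHarmonic p n) * (z + w * genHarmonic m n))
      = x * z * diffSeries a b e (fun _ => 1) + x * w * diffSeries a b e (genHarmonic m)
        + y * z * diffSeries a b e (genHarmonic p)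
        + y * w * diffSeries a b e (fun n => genHarmonic p n * genHarmonic m n) := by
  have h := (((halfGrowth_one.hasSum a b e).mul_left (x * z)).add
    (((halfGrowth_genHarmonic hm).hasSum a b e).mul_left (x * w))).add
    (((halfGrowth_genHarmonic hp).hasSum a b e).mul_left (y * z)) |>.add
    (((halfGrowth_genHarmonic_mul hp hm).hasSum a b e).mul_left (y * w))
  rw [← h.tsum_eq, diffSeries]
  exact tsum_congr fun n => by ring

theorem sum_diffSeries_cotCoeffLim (M : ℕ) {a b : ℂ} (ha : ∀ n : ℤ, a ≠ n) (hb : ∀ n : ℤ, b ≠ n) :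
    ∑ k ∈ Finset.range (M + 1), diffSeries a b (M + 1 - k) (fun _ => cotCoeffLim k)
      = -2 * ∑ k ∈ Finset.range (M / 2 + 1), zetaNat (2 * k) *
          (hurwitzNat (M + 1 - 2 * k) a - hurwitzNat (M + 1 - 2 * k) b) := by
  rw [← sum_cotCoeffLim_mul M fun k => hurwitzNat (M + 1 - k) a - hurwitzNat (M + 1 - k) b]
  refine Finset.sum_congr rfl fun k hk => ?_
  rw [Finset.mem_range] at hk
  rw [← diffSeries_one ha hb (by omega), diffSeries, diffSeries, ← tsum_mul_left]
  simp only [one_mul]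

end DiffSeries

/-! ### Assembly of the identity. -/

theorem mainTheorem4 (p m : ℕ) (hp : 1 ≤ p) (hm : 1 ≤ m) (a b : ℂ)
    (ha : ∀ n : ℤ, a ≠ (n : ℂ)) (hb : ∀ n : ℤ, b ≠ (n : ℂ)) (hab : a ≠ b) :
    Summable (fun n : ℕ+ => genHarmonic p n * genHarmonic m n /
      ((((n : ℕ) : ℂ) + a) * (((n : ℕ) : ℂ) + b))) ∧
    Summable (fun n : ℕ+ => genHarmonic p ((n : ℕ) - 1) * genHarmonic m ((n : ℕ) - 1) /
      ((((n : ℕ) : ℂ) - a) * (((n : ℕ) : ℂ) - b))) ∧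
    (∀ q : ℕ, 1 ≤ q →
      Summable (fun n : ℕ+ => genHarmonic q n / ((((n : ℕ) : ℂ) + a) * (((n : ℕ) : ℂ) + b))) ∧
      Summable (fun n : ℕ+ => genHarmonic q ((n : ℕ) - 1) / ((((n : ℕ) : ℂ) - a) * (((n : ℕ) : ℂ) - b)))) ∧
    (∀ q e : ℕ, 1 ≤ q → 1 ≤ e →
      Summable (fun n : ℕ => genHarmonic q n / ((n : ℂ) + a) ^ e
        - genHarmonic q n / ((n : ℂ) + b) ^ e)) ∧
    (∑' n : ℕ+, genHarmonic p n * genHarmonic m n / ((((n : ℕ) : ℂ) + a) * (((n : ℕ) : ℂ) + b)))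
      + (-1) ^ (p + m) * (∑' n : ℕ+, genHarmonic p ((n : ℕ) - 1) * genHarmonic m ((n : ℕ) - 1) /
          ((((n : ℕ) : ℂ) - a) * (((n : ℕ) : ℂ) - b)))
      + (-1) ^ m * zetaNat m *
          (∑' n : ℕ+, genHarmonic p n / ((((n : ℕ) : ℂ) + a) * (((n : ℕ) : ℂ) + b)))
      + (-1) ^ p * zetaNat p *
          (∑' n : ℕ+, genHarmonic m n / ((((n : ℕ) : ℂ) + a) * (((n : ℕ) : ℂ) + b)))
      - (-1) ^ (p + m) * zetaNat m *
          (∑' n : ℕ+, genHarmonic p ((n : ℕ) - 1) / ((((n : ℕ) : ℂ) - a) * (((n : ℕ) : ℂ) - b)))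
      - (-1) ^ (p + m) * zetaNat p *
          (∑' n : ℕ+, genHarmonic m ((n : ℕ) - 1) / ((((n : ℕ) : ℂ) - a) * (((n : ℕ) : ℂ) - b)))
      + (-1) ^ (p + m) * (Real.pi * Complex.cot (Real.pi * b) / (b - a)) *
          (hurwitzNat p b * hurwitzNat m b - zetaNat p * zetaNat m)
      - (-1) ^ (p + m) * (Real.pi * Complex.cot (Real.pi * a) / (b - a)) *
          (hurwitzNat p a * hurwitzNat m a - zetaNat p * zetaNat m)
      - 2 * ((-1) ^ (p + m) / (b - a)) *
          (∑ k ∈ Finset.range ((p + m) / 2 + 1), zetaNat (2 * k) *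
            (hurwitzNat (p + m + 1 - 2 * k) a - hurwitzNat (p + m + 1 - 2 * k) b))
      + 2 * ((-1) ^ (p + m) / (b - a)) * crossSum p m a b
      + 2 * ((-1) ^ (p + m) / (b - a)) * crossSum m p a b
      = 0 := by
  have H1 := (halfGrowth_genHarmonic_mul hp hm).hasSum_pnat_add (by simp [genHarmonic]) ha hb hab
  have H2 := (halfGrowth_genHarmonic_mul hp hm).hasSum_pnat_sub ha hb hab
  have H3 : ∀ {q : ℕ}, 1 ≤ q → _ := fun {q} hq =>
    (halfGrowth_genHarmonic (q := q) hq).hasSum_pnat_add (by simp [genHarmonic]) ha hb hab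
  have H4 : ∀ {q : ℕ}, 1 ≤ q → _ := fun {q} hq =>
    (halfGrowth_genHarmonic (q := q) hq).hasSum_pnat_sub ha hb hab
  refine ⟨H1.summable, H2.summable, fun q hq => ⟨(H3 hq).summable, (H4 hq).summable⟩,
    fun q e hq _ => ?_, ?_⟩
  · refine ((halfGrowth_genHarmonic hq).summable a b e).congr fun n => ?_
    rw [mul_sub, mul_one_div, mul_one_div]
  rw [H1.tsum_eq, H2.tsum_eq, (H3 hp).tsum_eq, (H3 hm).tsum_eq, (H4 hp).tsum_eq, (H4 hm).tsum_eq]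
  have E := cot_mul_hurwitzNat_sub hp hm ha hb
  rw [sum_diffSeries_cotCoeffLim (p + m) ha hb, sum_diffSeries_eq_crossSum m hp ha hb,
    sum_diffSeries_eq_crossSum p hm ha hb] at E
  have R : (fun n => hurwitzCoeffLim p 0 n * hurwitzCoeffLim m 0 n) = fun n =>
      (zetaNat p + (-1) ^ p * genHarmonic p n) * (zetaNat m + (-1) ^ m * genHarmonic m n) := by
    funext n
    simp [hurwitzCoeffLim]
  have S : (fun n => (zetaNat p - genHarmonic p n) * (zetaNat m - genHarmonic m n)) = fun n =>
      (zetaNat p + -1 * genHarmonic p n) * (zetaNat m + -1 * genHarmonic m n) := by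
    funext n
    ring
  rw [R, S, diffSeries_affine_mul hp hm, diffSeries_affine_mul hp hm] at E
  have T := cot_sub_cot ha hb
  have hu : ((-1 : ℂ) ^ p) * (-1) ^ p = 1 := by rw [← mul_pow]; norm_num
  have hv : ((-1 : ℂ) ^ m) * (-1) ^ m = 1 := by rw [← mul_pow]; norm_num
  rw [pow_add]
  simp only [div_eq_mul_inv]
  generalize (b - a)⁻¹ = d
  generalize ((-1 : ℂ) ^ p) = u at *
  generalize ((-1 : ℂ) ^ m) = v at *
  -- Here `u`, `v`, `d` stand for `(-1)^p`, `(-1)^m`, `(b-a)⁻¹`. The expansion `E` is scaled by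
  -- `-(-1)^(p+m)/(b-a)`, `T` trades the constant series for the terms `ζ(p)ζ(m)` in the cotangent
  -- brackets, and `hu`, `hv` clear the squared signs.
  linear_combination (-u * v * d) * E + (u * v * d * zetaNat p * zetaNat m) * T
    - (v * zetaNat m * diffSeries a b 1 (genHarmonic p) * d
      + diffSeries a b 1 (fun n => genHarmonic p n * genHarmonic m n) * d * v ^ 2) * hu
    - (u * zetaNat p * diffSeries a b 1 (genHarmonic m) * d
      + diffSeries a b 1 (fun n => genHarmonic p n * genHarmonic m n) * d) * hv
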